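/- Setting. Let $S$, $A$ also denote the sizes of finite state and action spaces $\mathcal S,\mathcal A$, and let $H\ge 1$. For each parameter $\theta$ in a measurable space $\Theta$ let $\mathcal M(\theta)$ be the episodic MDP with known initial distribution $\nu$, known rewards $r_h(s,a)\in[0,1]$ ($0\le h<H$) and terminal reward $r_H(s)\in[0,1]$, and transition probabilities $P^\theta_h(s'\mid s,a)$, measurable in $\theta$. Put $V^*_H(s;\theta)=r_H(s)$, $Q^*_h(s,a;\theta)=r_h(s,a)+\sum_{s'}P_h^\theta(s'\mid s,a)V^*_{h+1}(s';\theta)$ and $V^*_h(s;\theta)=\max_aQ^*_h(s,a;\theta)$ for $h<H$. Let $\pi^*(\theta)$ be an optimal policy of $\mathcal M(\theta)$, measurable in $\theta$, i.e. one that maximizes $\sum_a Q_h^*(s,a;\theta)\pi_h(a\mid s)$ at each $(h,s)$, $h<H$, that it visits with positive probability in $\mathcal M(\theta)$. Let $p_h(s;\theta)=\Pr_{\theta,\pi^*(\theta)}(s_h=s)$. The true parameter $\theta^*$ has a prior distribution $\mu_0$ on $\Theta$. Given $\theta^*$, the offline dataset $\mathcal D_0$ consists of $L$ independent trajectories $(\bar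 s_0,\bar a_0,\dots,\bar s_H)$ in $\mathcal M(\theta^*)$ of an expert who plays $\pi^\beta_h(a\mid s)\propto\exp(\beta Q_h^*(s,a;\theta^*))$, $\beta\ge 0$. In each online episode $t=1,\dots,T$ the algorithm iPSRL draws $\tilde\theta_t$ from the exact posterior distribution of $\theta^*$ given $\mathcal D_0$ and the online episodes $1,\dots,t-1$ (Bayes' rule with the expert's policy known), and runs $\pi^*(\tilde\theta_t)$ for one episode $(s^t_0,a^t_0,\dots,s^t_H)$ in $\mathcal M(\theta^*)$. Its Bayesian regret is $$\mathfrak{BR}_T=\mathbb E\Big[\sum_{t=1}^T\Big(V^*_0(s_0^t;\theta^*)-\sum_{h=0}^{H-1}r_h(s_h^t,a_h^t)-r_H(s_H^t)\Big)\Big].$$ Assumptions. (i) There is $\Delta>0$ such that for all $\theta\in\Theta$, $0\le h<H$, $s\in\mathcal S$ there is $a^*\in\mathcal A$ with $Q^*_h(s,a^*;\theta)\ge Q^*_h(s,a';\theta)+\Delta$ for all $a'\ne a^*$. (ii) $\underline p:=\inf\{p_h(s;\theta): 0\le h<H,\ s\in\mathcal S,\ \theta\in\Theta,\ p_h(s;\theta)>0\}>0$.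 Theorem. There is a universal constant $C>0$, and there are $\beta_0\in\mathbb{R}$ and $c>0$ depending only on $H,A,\Delta,\underline p$ (in particular not on $L$ or $T$), such that for every such problem and all $\beta\ge\max\{\beta_0,0\}$ and $T\ge1$: (a) for every $L\ge0$, $$\mathfrak{BR}_T\le C\sqrt{\varepsilon_L H^4S^2AT}\,(1+\log T),\qquad \varepsilon_L=\min\Big\{1,\,2SH\Big[\exp\Big(-\frac{L\underline p^2}{18}\Big)+\exp\Big(-\frac{L\underline p}{36}\Big)\Big]\Big\};$$ (b) the regret decays to zero exponentially fast in the size $N=LH$ of the offline dataset: there is a $K$ independent of $L$ with $|\mathfrak{BR}_T|\le K e^{-cN}$ for all $L\ge 0$. -/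

import Mathlib

open MeasureTheory

noncomputable section

/-- A trajectory `(s_0, a_0, s_1, a_1, …, a_{H-1}, s_H)` of one episode. -/
abbrev Traj (S A : Type*) (H : ℕ) : Type _ := (Fin (H + 1) → S) × (Fin H → A)

/-- A (randomized, Markov) policy: `π h s a` is the probability of playing `a` in state `s` at
period `h`.  That `π h s` is a probability vector is required where policies are used. -/
abbrev Policy (S A : Type*) (H : ℕ) : Type _ := Fin H → S → A → ℝ

/-- A family `M(θ)`, `θ ∈ Θ`, of finite-horizon tabular Markov decision processes with known
initial distribution `ν`, known running rewards `r` and terminal reward `rT` (all in `[0, 1]`),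
and transition probabilities `P θ` parametrized by the unknown `θ`.  The case in which the
transition table itself is unknown is that of `Θ` a set of transition tables and `P` the
inclusion. -/
structure MDPFamily (S A Θ : Type*) [Fintype S] [MeasurableSpace Θ] (H : ℕ) where
  /-- initial state distribution -/
  ν : S → ℝ
  ν_mem : ν ∈ stdSimplex ℝ S
  /-- reward at the periods `0, …, H - 1` -/
  r : Fin H → S → A → ℝ
  r_mem : ∀ h s a, r h s a ∈ Set.Icc (0 : ℝ) 1
  /-- terminal reward, received at period `H` -/
  rT : S → ℝ
  rT_mem : ∀ s, rT s ∈ Set.Icc (0 : ℝ) 1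
  /-- `P θ h s a s'` is the probability under `θ` of moving from `s` to `s'` with `a` -/
  P : Θ → Fin H → S → A → S → ℝ
  P_mem : ∀ θ h s a, P θ h s a ∈ stdSimplex ℝ S
  P_measurable : ∀ h s a s', Measurable fun θ => P θ h s a s'

namespace MDPFamily

variable {S A Θ : Type*} [Fintype S] [MeasurableSpace Θ] {H : ℕ}

/-- Optimal state values `V*_h(s; θ)`, `0 ≤ h ≤ H`, by backward induction. -/
def V (M : MDPFamily S A Θ H) (θ : Θ) : Fin (H + 1) → S → ℝ :=
  Fin.reverseInduction (motive := fun _ => S → ℝ) M.rT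
    (fun h Vnext s => ⨆ a, (M.r h s a + ∑ s', M.P θ h s a s' * Vnext s'))

/-- Optimal state-action values `Q*_h(s, a; θ)`, `0 ≤ h < H`. -/
def Q (M : MDPFamily S A Θ H) (θ : Θ) (h : Fin H) (s : S) (a : A) : ℝ :=
  M.r h s a + ∑ s', M.P θ h s a s' * M.V θ h.succ s'

/-- At the final period the value is the terminal reward. -/
theorem V_last (M : MDPFamily S A Θ H) (θ : Θ) : M.V θ (Fin.last H) = M.rT := by
  simp only [V, Fin.reverseInduction_last]

/-- Bellman equation: `V*_h(s; θ) = max_a Q*_h(s, a; θ)`. -/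
theorem V_castSucc (M : MDPFamily S A Θ H) (θ : Θ) (h : Fin H) (s : S) :
    M.V θ h.castSucc s = ⨆ a, M.Q θ h s a := by
  simp only [V, Q, Fin.reverseInduction_castSucc]

variable [Fintype A]

/-- The probability of the trajectory `τ` when the policy `π` is run in `M(θ)`. -/
def trajProb (M : MDPFamily S A Θ H) (θ : Θ) (π : Policy S A H) (τ : Traj S A H) : ℝ :=
  M.ν (τ.1 0) * ∏ h : Fin H,
    (π h (τ.1 h.castSucc) (τ.2 h) * M.P θ h (τ.1 h.castSucc) (τ.2 h) (τ.1 h.succ))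

/-- The total reward collected along a trajectory, terminal reward included. -/
def totalReward (M : MDPFamily S A Θ H) (τ : Traj S A H) : ℝ :=
  (∑ h : Fin H, M.r h (τ.1 h.castSucc) (τ.2 h)) + M.rT (τ.1 (Fin.last H))

open Classical in
/-- `Pr_{θ, π}(s_h = s)` for a period `h < H`. -/
def stateProb (M : MDPFamily S A Θ H) (θ : Θ) (π : Policy S A H) (h : Fin H) (s : S) : ℝ :=
  ∑ τ : Traj S A H, if τ.1 h.castSucc = s then M.trajProb θ π τ else 0

/-- `π` is an optimal policy for `M(θ)`: at each period and state that it reaches with positive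
probability in `M(θ)`, it maximizes `∑ a, Q*_h(s, a; θ) q(a)` over the probability vectors `q` on
actions.  Policies that do so in all states are included; the behaviour at states that are never
reached under `θ` is left free. -/
def IsOptimal (M : MDPFamily S A Θ H) (θ : Θ) (π : Policy S A H) : Prop :=
  (∀ h s, π h s ∈ stdSimplex ℝ A) ∧
  ∀ h s, 0 < M.stateProb θ π h s →
    ∀ q ∈ stdSimplex ℝ A, ∑ a, M.Q θ h s a * q a ≤ ∑ a, M.Q θ h s a * π h s a

/-- A planner: a measurable rule that assigns to each `θ` an optimal policy of `M(θ)`. -/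
structure IsPlanner (M : MDPFamily S A Θ H) (opt : Θ → Policy S A H) : Prop where
  optimal : ∀ θ, M.IsOptimal θ (opt θ)
  measurable : ∀ h s a, Measurable fun θ => opt θ h s a

/-- Uniform gap: for all `θ`, `h`, `s` some action beats all the others by at least `Δ`. -/
def HasGap (M : MDPFamily S A Θ H) (Δ : ℝ) : Prop :=
  ∀ (θ : Θ) (h : Fin H) (s : S), ∃ a : A, ∀ b : A, b ≠ a → M.Q θ h s b + Δ ≤ M.Q θ h s a

/-- The infimum, over all `θ`, of the positive probabilities `p_h(s; θ)`, `h < H`, with which the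
optimal policy of `M(θ)` visits `s` at period `h` in `M(θ)`. -/
def minReachProb (M : MDPFamily S A Θ H) (opt : Θ → Policy S A H) : ℝ :=
  sInf {x : ℝ | ∃ (θ : Θ) (h : Fin H) (s : S), x = M.stateProb θ (opt θ) h s ∧ 0 < x}

/-- The expert's softmax policy with deliberateness `β`. -/
def expert (M : MDPFamily S A Θ H) (β : ℝ) (θ : Θ) : Policy S A H :=
  fun h s a => Real.exp (β * M.Q θ h s a) / ∑ b, Real.exp (β * M.Q θ h s b)

/-- The probability under `θ` of the offline dataset `d`: `L` independent episodes of the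
expert. -/
def offlineProb (M : MDPFamily S A Θ H) (β : ℝ) (θ : Θ) {L : ℕ} (d : Fin L → Traj S A H) : ℝ :=
  ∏ l, M.trajProb θ (M.expert β θ) (d l)

/-- The factor of the probability of an online episode that depends on the environment: initial
state and transitions.  The agent's own action probabilities given the data it has seen do not
involve the true parameter, so they cancel in Bayes' rule. -/
def transLik (M : MDPFamily S A Θ H) (θ : Θ) (τ : Traj S A H) : ℝ :=
  M.ν (τ.1 0) * ∏ h : Fin H, M.P θ h (τ.1 h.castSucc) (τ.2 h) (τ.1 h.succ)

/-- The likelihood of `θ` given the offline dataset `d` and the online episodes before episode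
`t`. -/
def likelihood (M : MDPFamily S A Θ H) (β : ℝ) {L T : ℕ} (d : Fin L → Traj S A H)
    (τ : Fin T → Traj S A H) (t : Fin T) (θ : Θ) : ℝ :=
  M.offlineProb β θ d * ∏ j ∈ Finset.Iio t, M.transLik θ (τ j)

/-- The posterior of the parameter at the start of online episode `t`, by Bayes' rule: prior times
likelihood, normalized. -/
def posterior (M : MDPFamily S A Θ H) (μ₀ : Measure Θ) (β : ℝ) {L T : ℕ}
    (d : Fin L → Traj S A H) (τ : Fin T → Traj S A H) (t : Fin T) : Measure Θ :=
  (∫⁻ θ, ENNReal.ofReal (M.likelihood β d τ t θ) ∂μ₀)⁻¹ •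
    μ₀.withDensity fun θ => ENNReal.ofReal (M.likelihood β d τ t θ)

/-- The conditional probability, given true parameter `θ`, offline dataset `d` and the online
episodes before `t`, that episode `t` of iPSRL is `τ t`: a parameter `θ'` is drawn from the current
posterior, and the optimal policy for `θ'` is run for one episode in `M(θ)`. -/
def episodeProb (M : MDPFamily S A Θ H) (opt : Θ → Policy S A H) (μ₀ : Measure Θ) (β : ℝ)
    {L T : ℕ} (θ : Θ) (d : Fin L → Traj S A H) (τ : Fin T → Traj S A H) (t : Fin T) : ℝ :=
  ∫ θ', M.trajProb θ (opt θ') (τ t) ∂(M.posterior μ₀ β d τ t)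

/-- The conditional probability, given true parameter `θ`, that the offline dataset is `d` and the
online episodes of iPSRL are `τ 0, …, τ (T - 1)`. -/
def runProb (M : MDPFamily S A Θ H) (opt : Θ → Policy S A H) (μ₀ : Measure Θ) (β : ℝ)
    {L T : ℕ} (θ : Θ) (d : Fin L → Traj S A H) (τ : Fin T → Traj S A H) : ℝ :=
  M.offlineProb β θ d * ∏ t, M.episodeProb opt μ₀ β θ d τ t

/-- Bayesian regret of iPSRL over `T` episodes with an offline dataset of `L` episodes: the
expectation, over the true parameter `θ ∼ μ₀`, the offline dataset and the online episodes, of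
`∑ t, (V*_0(s_0^t; θ) - total reward of episode t)`. -/
def bayesRegret (M : MDPFamily S A Θ H) (opt : Θ → Policy S A H) (μ₀ : Measure Θ) (β : ℝ)
    (L T : ℕ) : ℝ :=
  ∫ θ, (∑ d : Fin L → Traj S A H, ∑ τ : Fin T → Traj S A H,
    M.runProb opt μ₀ β θ d τ * ∑ t, (M.V θ 0 ((τ t).1 0) - M.totalReward (τ t))) ∂μ₀

end MDPFamily

/-- `ε_L = min {1, 2 S H [exp(-L p² / 18) + exp(-L p / 36)]}`, with `nS` the number of states. -/
def epsL (nS H : ℕ) (p : ℝ) (L : ℕ) : ℝ :=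
  min 1 (2 * nS * H * (Real.exp (-(L * p ^ 2 / 18)) + Real.exp (-(L * p / 36))))

end

/-! Call a triple (period, state, action) reached by `θ` if the optimal policy of `θ` visits it with
positive probability in `M(θ)`. By the gap, the optimal action at each reached state is unique, so
two parameters with the same reached triples have optimal policies that agree wherever either one
goes. Playing the policy of one in the environment of the other then costs nothing
(`IsOptimal.regret_eq_zero_of_reached_eq`), and all regret lives on the mismatch event, where the
truth `θ` and the posterior sample `θ'` reach different triples.

Mismatch is rare because the offline data reveal the reached triples. For large `β` the expert is
close in total variation to the optimal policy, and the triples seen in at least `L p / 2` episodes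
are exactly the reached ones, except on an event that Chernoff bounds make exponentially unlikely.
Given the data, `θ` and `θ'` are exchangeable (`expectPair_swap`), so `θ'` differs from this
data-dependent set no more often than `θ` does, and a union bound gives `expectPair_mismatch_le`.
Multiplying by the largest possible regret per episode proves (b).

For (a), mismatch is a symmetric function of the pair. Hence, under the expectation and on this
event, the optimal value of `θ` may be replaced by that of `θ'`. What remains is the difference
between the values of one policy in two environments, at most `H + 1` times the sum of the `ℓ¹`
distances of their transition probabilities along an episode. The inequality `m d ≤ m / (2 k) + k d²
/ 2` for an indicator `m` separates the probability of mismatch from the squared distances, and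
optimizing `k` produces the factor `√ε`.

The squared distances are bounded in expectation, without confidence sets. Both transition laws are
compared with the empirical one. The relative entropy of the empirical law to its midpoint with the
true law controls the squared `ℓ¹` error, and the number of observations times this entropy is the
logarithm of a likelihood ratio. Summed over all possible count vectors, such ratios have
expectation at most `(T + 1) ^ S`, each being a supermartingale (`expect_prod_midRatio_le`);
exchangeability carries the bound to `θ'`. The inverse visit counts that remain add up to a harmonic
sum for each triple (`sum_expectPair_inv_visitCount_le`). -/

noncomputable section

/-! ### Weighted paths -/

section Paths

variable {S A : Type*} [Fintype S] [Fintype A]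

/-- The weight of a trajectory for an initial weight `ν` and weights `K h s a s'` of the moves. -/
def pathWeight {n : ℕ} (ν : S → ℝ) (K : Fin n → S → A → S → ℝ) (x : Traj S A n) : ℝ :=
  ν (x.1 0) * ∏ h : Fin n, K h (x.1 h.castSucc) (x.2 h) (x.1 h.succ)

theorem sum_traj_zero (F : Traj S A 0 → ℝ) :
    ∑ x, F x = ∑ s, F (fun _ => s, Fin.elim0) := by
  rw [Fintype.sum_prod_type]
  simp only [Fintype.sum_unique]
  refine (Fintype.sum_equiv (Equiv.funUnique (Fin 1) S).symm _ _ fun s => ?_).symm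
  congr 1

theorem sum_traj_succ {n : ℕ} (F : Traj S A (n + 1) → ℝ) :
    ∑ x, F x = ∑ s, ∑ a, ∑ y : Traj S A n, F (Fin.cons s y.1, Fin.cons a y.2) := by
  rw [Fintype.sum_prod_type]
  rw [← Fintype.sum_equiv (Fin.consEquiv fun _ : Fin (n + 2) => S) (fun z => ∑ w, F (Fin.cons z.1 z.2, w)) _
    (fun z => rfl), Fintype.sum_prod_type]
  refine Finset.sum_congr rfl fun s _ => ?_
  have h2 : ∀ v : Fin (n + 1) → S, ∑ w, F (Fin.cons s v, w) =
      ∑ a, ∑ w : Fin n → A, F (Fin.cons s v, Fin.cons a w) := by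
    intro v
    rw [← Fintype.sum_equiv (Fin.consEquiv fun _ : Fin (n + 1) => A)
      (fun z => F (Fin.cons s v, Fin.cons z.1 z.2)) _ (fun z => rfl), Fintype.sum_prod_type]
  simp only [h2]
  rw [Finset.sum_comm]
  refine Finset.sum_congr rfl fun a _ => ?_
  rw [Fintype.sum_prod_type]

-- The first move is absorbed into the initial weight. This is why `ν` is an arbitrary weight rather
-- than a probability vector: the inductions on the length of a path need it in this generality.
omit [Fintype S] [Fintype A] in
theorem pathWeight_cons {n : ℕ} (ν : S → ℝ) (K : Fin (n + 1) → S → A → S → ℝ) (s : S) (a : A)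
    (y : Traj S A n) :
    pathWeight ν K (Fin.cons s y.1, Fin.cons a y.2) =
      pathWeight (fun s' => ν s * K 0 s a s') (fun h => K h.succ) y := by
  simp only [pathWeight, Fin.prod_univ_succ, Fin.cons_zero, Fin.cons_succ, Fin.castSucc_zero,
    ← Fin.succ_castSucc]
  ring

theorem sum_pathWeight {n : ℕ} (ν : S → ℝ) (K : Fin n → S → A → S → ℝ)
    (hK : ∀ h s, ∑ a, ∑ s', K h s a s' = 1) : ∑ x, pathWeight ν K x = ∑ s, ν s := by
  induction n generalizing ν with
  | zero => simp [sum_traj_zero, pathWeight]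
  | succ n ih =>
    rw [sum_traj_succ]
    simp only [pathWeight_cons]
    refine Finset.sum_congr rfl fun s _ => ?_
    simp only [ih _ (fun h => K h.succ) fun h => hK h.succ, ← Finset.mul_sum, hK, mul_one]

/-- Markov property: a function of the move made at period `h` may be replaced by its conditional
expectation given the state at that period. -/
theorem sum_pathWeight_mul {n : ℕ} (ν : S → ℝ) (K : Fin n → S → A → S → ℝ)
    (hK : ∀ h s, ∑ a, ∑ s', K h s a s' = 1) (h : Fin n) (g : S → A → S → ℝ) :
    ∑ x, pathWeight ν K x * g (x.1 h.castSucc) (x.2 h) (x.1 h.succ) =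
      ∑ x, pathWeight ν K x *
        ∑ a, ∑ s', K h (x.1 h.castSucc) a s' * g (x.1 h.castSucc) a s' := by
  induction n generalizing ν with
  | zero => exact h.elim0
  | succ n ih =>
    rw [sum_traj_succ, sum_traj_succ]
    simp only [pathWeight_cons]
    refine Finset.sum_congr rfl fun s _ => ?_
    cases h using Fin.cases with
    | zero =>
      have h1 : ∀ a, ∑ y : Traj S A n, pathWeight (fun s' => ν s * K 0 s a s') (fun h => K h.succ) y
          * g s a (y.1 0) = ν s * ∑ s', K 0 s a s' * g s a s' := by
        intro a
        have := sum_pathWeight (fun s' => ν s * K 0 s a s' * g s a s') (fun h => K h.succ)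
          fun h => hK h.succ
        rw [Finset.mul_sum]
        simp only [← mul_assoc]
        rw [← this]
        refine Finset.sum_congr rfl fun y _ => ?_
        simp only [pathWeight]
        ring
      simp only [Fin.castSucc_zero, Fin.cons_zero, Fin.cons_succ, h1, ← Finset.mul_sum,
        ← Finset.sum_mul, sum_pathWeight _ (fun h => K h.succ) fun h => hK h.succ, hK, mul_one]
    | succ h =>
      refine Finset.sum_congr rfl fun a _ => ?_
      simpa only [← Fin.succ_castSucc, Fin.cons_succ] using
        ih (fun s' => ν s * K 0 s a s') (fun h => K h.succ) (fun h => hK h.succ) h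

omit [Fintype S] [Fintype A] in
theorem pathWeight_nonneg {n : ℕ} {ν : S → ℝ} {K : Fin n → S → A → S → ℝ}
    (hν : ∀ s, 0 ≤ ν s) (hK : ∀ h s a s', 0 ≤ K h s a s') (x : Traj S A n) :
    0 ≤ pathWeight ν K x :=
  mul_nonneg (hν _) (Finset.prod_nonneg fun _ _ => hK _ _ _ _)

/-- Two Markov chains with the same initial law are as close in total variation as their moves are
on average along one of them. -/
theorem sum_abs_pathWeight_sub_le {n : ℕ} (ν : S → ℝ) (K K' : Fin n → S → A → S → ℝ)
    (hν : ∀ s, 0 ≤ ν s) (hK : ∀ h s, ∑ a, ∑ s', K h s a s' = 1)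
    (hK' : ∀ h s, ∑ a, ∑ s', K' h s a s' = 1) (hK0 : ∀ h s a s', 0 ≤ K h s a s')
    (hK0' : ∀ h s a s', 0 ≤ K' h s a s') :
    ∑ x, |pathWeight ν K' x - pathWeight ν K x| ≤
      ∑ x, pathWeight ν K x * ∑ h : Fin n, ∑ a, ∑ s',
        |K' h (x.1 h.castSucc) a s' - K h (x.1 h.castSucc) a s'| := by
  induction n generalizing ν with
  | zero => simp [pathWeight]
  | succ n ih =>
    rw [sum_traj_succ, sum_traj_succ]
    simp only [pathWeight_cons]
    refine Finset.sum_le_sum fun s _ => ?_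
    -- Hybrid argument: exchange the first move while the tail still follows `K'`, then exchange the
    -- tail from the weight left by `K`. Only the chain of `K` does the averaging.
    have h1 : ∀ a, ∑ y : Traj S A n,
        |pathWeight (fun s' => ν s * K' 0 s a s') (fun h => K' h.succ) y -
          pathWeight (fun s' => ν s * K 0 s a s') (fun h => K h.succ) y| ≤
        ν s * ∑ s', |K' 0 s a s' - K 0 s a s'| +
        ∑ y : Traj S A n, pathWeight (fun s' => ν s * K 0 s a s') (fun h => K h.succ) y *
          ∑ h : Fin n, ∑ b, ∑ s',
            |K' h.succ (y.1 h.castSucc) b s' - K h.succ (y.1 h.castSucc) b s'| := by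
      intro a
      have e1 := sum_pathWeight (fun s' => ν s * |K' 0 s a s' - K 0 s a s'|)
        (fun h => K' h.succ) fun h => hK' h.succ
      rw [← Finset.mul_sum] at e1
      rw [← e1]
      refine le_trans ?_ (add_le_add_right (ih (fun s' => ν s * K 0 s a s') (fun h => K h.succ)
        (fun h => K' h.succ) (fun s' => mul_nonneg (hν s) (hK0 _ _ _ _)) (fun h => hK h.succ)
        (fun h => hK' h.succ) (fun h => hK0 h.succ) (fun h => hK0' h.succ)) _)
      rw [← Finset.sum_add_distrib]
      refine Finset.sum_le_sum fun y _ => ?_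
      refine le_trans (le_of_eq ?_) ((abs_add_le
        (pathWeight (fun s' => ν s * (K' 0 s a s' - K 0 s a s')) (fun h => K' h.succ) y) _).trans
        (add_le_add_left (le_of_eq ?_) _))
      · congr 1
        simp only [pathWeight]
        ring
      · simp only [pathWeight, abs_mul, abs_of_nonneg (hν s)]
        rw [abs_of_nonneg (Finset.prod_nonneg fun _ _ => hK0' _ _ _ _)]
    refine (Finset.sum_le_sum fun a _ => h1 a).trans (le_of_eq ?_)
    simp only [Fin.sum_univ_succ, Fin.castSucc_zero, Fin.cons_zero, ← Fin.succ_castSucc,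
      Fin.cons_succ, mul_add, Finset.sum_add_distrib]
    congr 1
    simp only [← Finset.sum_mul, sum_pathWeight _ (fun h => K h.succ) fun h => hK h.succ,
      ← Finset.mul_sum, hK, mul_one]

end Paths

/-! ### Running a policy in an MDP -/

theorem Fin.sum_castSucc_sub_succ {n : ℕ} (f : Fin (n + 1) → ℝ) :
    ∑ i : Fin n, (f i.castSucc - f i.succ) = f 0 - f (Fin.last n) := by
  have h1 := Fin.sum_univ_castSucc f
  have h2 := Fin.sum_univ_succ f
  rw [Finset.sum_sub_distrib]
  linarith

namespace MDPFamily

section Basic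

variable {S A Θ : Type*} [Fintype S] [MeasurableSpace Θ] {H : ℕ} (M : MDPFamily S A Θ H)

/-- The policy `π` chooses actions according to probability vectors. -/
def IsPolicy [Fintype A] (π : Policy S A H) : Prop := ∀ h s, π h s ∈ stdSimplex ℝ A

/-- The probabilities of the moves when `π` is run in `M(θ)`. -/
def move (θ : Θ) (π : Policy S A H) (h : Fin H) (s : S) (a : A) (s' : S) : ℝ :=
  π h s a * M.P θ h s a s'

variable [Fintype A] {M} {θ θ' : Θ} {π π' : Policy S A H}

theorem sum_move (hπ : IsPolicy π) (h : Fin H) (s : S) :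
    ∑ a, ∑ s', M.move θ π h s a s' = 1 := by
  simp only [move, ← Finset.mul_sum, (M.P_mem θ h s _).2, mul_one, (hπ h s).2]

theorem move_nonneg (hπ : IsPolicy π) (h : Fin H) (s : S) (a : A) (s' : S) :
    0 ≤ M.move θ π h s a s' :=
  mul_nonneg ((hπ h s).1 a) ((M.P_mem θ h s a).1 s')

omit [Fintype A] in
theorem trajProb_eq_pathWeight (x : Traj S A H) :
    M.trajProb θ π x = pathWeight M.ν (M.move θ π) x := rfl

theorem trajProb_nonneg (hπ : IsPolicy π) (x : Traj S A H) : 0 ≤ M.trajProb θ π x :=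
  pathWeight_nonneg M.ν_mem.1 (move_nonneg hπ) x

theorem sum_trajProb (hπ : IsPolicy π) : ∑ x, M.trajProb θ π x = 1 :=
  (sum_pathWeight _ _ (sum_move hπ)).trans M.ν_mem.2

theorem sum_trajProb_mul_initial (hπ : IsPolicy π) (f : S → ℝ) :
    ∑ x, M.trajProb θ π x * f (x.1 0) = ∑ s, M.ν s * f s := by
  rw [← sum_pathWeight (fun s => M.ν s * f s) _ (sum_move (M := M) (θ := θ) hπ)]
  refine Finset.sum_congr rfl fun x _ => ?_
  simp only [trajProb_eq_pathWeight, pathWeight]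
  ring

theorem sum_trajProb_mul_move (hπ : IsPolicy π) (h : Fin H) (g : S → A → S → ℝ) :
    ∑ x, M.trajProb θ π x * g (x.1 h.castSucc) (x.2 h) (x.1 h.succ) =
      ∑ x, M.trajProb θ π x * ∑ a, π h (x.1 h.castSucc) a *
        ∑ s', M.P θ h (x.1 h.castSucc) a s' * g (x.1 h.castSucc) a s' := by
  simp only [trajProb_eq_pathWeight, sum_pathWeight_mul _ _ (sum_move hπ) h g, move,
    Finset.mul_sum, mul_assoc]

theorem stateProb_nonneg (hπ : IsPolicy π) (h : Fin H) (s : S) : 0 ≤ M.stateProb θ π h s := by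
  classical
  exact Finset.sum_nonneg fun x _ => by split_ifs <;> simp [trajProb_nonneg hπ]

theorem sum_trajProb_mul_state (h : Fin H) (f : S → ℝ) :
    ∑ x, M.trajProb θ π x * f (x.1 h.castSucc) = ∑ s, M.stateProb θ π h s * f s := by
  classical
  simp only [stateProb, Finset.sum_mul]
  rw [Finset.sum_comm]
  refine Finset.sum_congr rfl fun x _ => ?_
  rw [Finset.sum_eq_single (x.1 h.castSucc)] <;> simp +contextual [eq_comm]

theorem stateProb_le_one (hπ : IsPolicy π) (h : Fin H) (s : S) : M.stateProb θ π h s ≤ 1 := by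
  classical
  rw [← sum_trajProb (M := M) (θ := θ) hπ]
  exact Finset.sum_le_sum fun x _ => by split_ifs <;> simp [trajProb_nonneg hπ]

theorem sum_trajProb_mul_action (hπ : IsPolicy π) (h : Fin H) (g : S → A → ℝ) :
    ∑ x, M.trajProb θ π x * g (x.1 h.castSucc) (x.2 h) =
      ∑ s, M.stateProb θ π h s * ∑ a, π h s a * g s a := by
  rw [← sum_trajProb_mul_state h fun s => ∑ a, π h s a * g s a,
    sum_trajProb_mul_move hπ h fun s a _ => g s a]
  simp only [← Finset.sum_mul, (M.P_mem θ h _ _).2, one_mul]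

theorem sum_abs_trajProb_sub_policy_le (hπ : IsPolicy π) (hπ' : IsPolicy π') :
    ∑ x, |M.trajProb θ π' x - M.trajProb θ π x| ≤
      ∑ h, ∑ s, M.stateProb θ π h s * ∑ a, |π' h s a - π h s a| := by
  refine (sum_abs_pathWeight_sub_le M.ν (M.move θ π) (M.move θ π') M.ν_mem.1 (sum_move hπ)
    (sum_move hπ') (move_nonneg hπ) (move_nonneg hπ')).trans (le_of_eq ?_)
  simp only [← trajProb_eq_pathWeight]
  simp only [Finset.mul_sum (Finset.univ : Finset (Fin H))]
  rw [Finset.sum_comm]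
  refine Finset.sum_congr rfl fun h _ => ?_
  rw [← sum_trajProb_mul_state h]
  simp only [move, ← sub_mul, abs_mul, abs_of_nonneg ((M.P_mem θ h _ _).1 _), ← Finset.mul_sum,
    (M.P_mem θ h _ _).2, mul_one]

theorem sum_abs_trajProb_sub_param_le (hπ : IsPolicy π) :
    ∑ x, |M.trajProb θ' π x - M.trajProb θ π x| ≤
      ∑ x, M.trajProb θ π x * ∑ h : Fin H, ∑ s',
        |M.P θ' h (x.1 h.castSucc) (x.2 h) s' - M.P θ h (x.1 h.castSucc) (x.2 h) s'| := by
  refine (sum_abs_pathWeight_sub_le M.ν (M.move θ π) (M.move θ' π) M.ν_mem.1 (sum_move hπ)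
    (sum_move hπ) (move_nonneg hπ) (move_nonneg hπ)).trans (le_of_eq ?_)
  simp only [← trajProb_eq_pathWeight]
  simp only [Finset.mul_sum (Finset.univ : Finset (Fin H))]
  rw [Finset.sum_comm, Finset.sum_comm (f := fun x h => M.trajProb θ π x * ∑ s',
    |M.P θ' h (x.1 h.castSucc) (x.2 h) s' - M.P θ h (x.1 h.castSucc) (x.2 h) s'|)]
  refine Finset.sum_congr rfl fun h _ => ?_
  rw [sum_trajProb_mul_action hπ h fun s a => ∑ s', |M.P θ' h s a s' - M.P θ h s a s'|,
    ← sum_trajProb_mul_state h]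
  simp only [move, ← mul_sub, abs_mul, abs_of_nonneg ((hπ h _).1 _), ← Finset.mul_sum]

/-- The probability of the actions of an episode given its states. -/
def actLik (π : Policy S A H) (x : Traj S A H) : ℝ := ∏ h : Fin H, π h (x.1 h.castSucc) (x.2 h)

-- The environment factor depends only on the parameter and the action factor only on the policy.
-- This separates the truth from the posterior sample in every later expectation.
omit [Fintype A] in
theorem trajProb_eq_mul (x : Traj S A H) : M.trajProb θ π x = M.transLik θ x * actLik π x := by
  simp only [trajProb, transLik, actLik, Finset.prod_mul_distrib]
  ring

theorem le_one_of_mem_stdSimplex {ι : Type*} [Fintype ι] {q : ι → ℝ} (hq : q ∈ stdSimplex ℝ ι)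
    (i : ι) : q i ≤ 1 :=
  hq.2 ▸ Finset.single_le_sum (fun j _ => hq.1 j) (Finset.mem_univ i)

omit [Fintype A] in
theorem transLik_mem (M : MDPFamily S A Θ H) (θ : Θ) (x : Traj S A H) :
    M.transLik θ x ∈ Set.Icc (0 : ℝ) 1 := by
  have h0 : 0 ≤ ∏ h : Fin H, M.P θ h (x.1 h.castSucc) (x.2 h) (x.1 h.succ) :=
    Finset.prod_nonneg fun h _ => (M.P_mem θ h _ _).1 _
  exact ⟨mul_nonneg (M.ν_mem.1 _) h0, mul_le_one₀ (le_one_of_mem_stdSimplex M.ν_mem _) h0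
    (Finset.prod_le_one (fun h _ => (M.P_mem θ h _ _).1 _)
      fun h _ => le_one_of_mem_stdSimplex (M.P_mem θ h _ _) _)⟩

omit [Fintype S] in
theorem actLik_mem (hπ : IsPolicy π) (x : Traj S A H) : actLik π x ∈ Set.Icc (0 : ℝ) 1 :=
  ⟨Finset.prod_nonneg fun h _ => (hπ h _).1 _,
    Finset.prod_le_one (fun h _ => (hπ h _).1 _) fun h _ => le_one_of_mem_stdSimplex (hπ h _) _⟩

omit [Fintype A] in
theorem totalReward_mem (M : MDPFamily S A Θ H) (x : Traj S A H) :
    M.totalReward x ∈ Set.Icc (0 : ℝ) (H + 1) := by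
  refine ⟨add_nonneg (Finset.sum_nonneg fun h _ => (M.r_mem _ _ _).1) (M.rT_mem _).1,
    add_le_add ?_ (M.rT_mem _).2⟩
  refine (Finset.sum_le_card_nsmul _ _ 1 fun h _ => (M.r_mem h _ _).2).trans ?_
  simp

theorem Q_le_V (M : MDPFamily S A Θ H) (θ : Θ) (h : Fin H) (s : S) (a : A) :
    M.Q θ h s a ≤ M.V θ h.castSucc s := by
  rw [V_castSucc]
  exact le_ciSup (Set.finite_range _).bddAbove a

theorem V_mem [Nonempty A] (M : MDPFamily S A Θ H) (θ : Θ) (h : Fin (H + 1)) (s : S) :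
    M.V θ h s ∈ Set.Icc (0 : ℝ) (H + 1 - h) := by
  induction h using Fin.reverseInduction generalizing s with
  | last => simpa [V_last] using M.rT_mem s
  | cast h ih =>
    have hQ : ∀ a, M.Q θ h s a ∈ Set.Icc (0 : ℝ) (H + 1 - h) := by
      intro a
      have h1 := M.r_mem h s a
      have hP := M.P_mem θ h s a
      have h2 : 0 ≤ ∑ s', M.P θ h s a s' * M.V θ h.succ s' :=
        Finset.sum_nonneg fun s' _ => mul_nonneg (hP.1 s') (ih s').1
      have h3 : ∑ s', M.P θ h s a s' * M.V θ h.succ s' ≤ H - h := by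
        calc _ ≤ ∑ s', M.P θ h s a s' * (H - h : ℝ) :=
              Finset.sum_le_sum fun s' _ => mul_le_mul_of_nonneg_left
                ((ih s').2.trans (by simp)) (hP.1 s')
          _ = _ := by rw [← Finset.sum_mul, hP.2, one_mul]
      refine ⟨add_nonneg h1.1 h2, ?_⟩
      have := h1.2
      unfold Q
      linarith
    rw [V_castSucc]
    exact ⟨le_ciSup_of_le (Set.finite_range _).bddAbove (Classical.arbitrary A) (hQ _).1,
      ciSup_le fun a => (hQ a).2⟩

/-- The expected total reward of `π` in `M(θ)`. -/
def value (M : MDPFamily S A Θ H) (θ : Θ) (π : Policy S A H) : ℝ :=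
  ∑ x, M.trajProb θ π x * M.totalReward x

/-- The expected regret of playing `π` for one episode in `M(θ)`. -/
def regret (M : MDPFamily S A Θ H) (θ : Θ) (π : Policy S A H) : ℝ :=
  ∑ x, M.trajProb θ π x * (M.V θ 0 (x.1 0) - M.totalReward x)

theorem regret_eq (hπ : IsPolicy π) :
    M.regret θ π = ∑ s, M.ν s * M.V θ 0 s - M.value θ π := by
  simp only [regret, mul_sub, Finset.sum_sub_distrib, value, sum_trajProb_mul_initial hπ]

/-- Performance difference identity: the optimal values telescope along a trajectory, and the Markov
property turns reward plus next value into `Q`. -/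
theorem regret_eq_sum (hπ : IsPolicy π) :
    M.regret θ π = ∑ h, ∑ s, M.stateProb θ π h s *
      ∑ a, π h s a * (M.V θ h.castSucc s - M.Q θ h s a) := by
  have h1 : ∀ x : Traj S A H, M.V θ 0 (x.1 0) - M.totalReward x =
      ∑ h : Fin H, (M.V θ h.castSucc (x.1 h.castSucc) - M.r h (x.1 h.castSucc) (x.2 h) -
        M.V θ h.succ (x.1 h.succ)) := by
    intro x
    have := Fin.sum_castSucc_sub_succ fun i => M.V θ i (x.1 i)
    simp only [V_last, Finset.sum_sub_distrib] at this
    simp only [totalReward, Finset.sum_sub_distrib]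
    linarith
  simp only [regret, h1, Finset.mul_sum (Finset.univ : Finset (Fin H))]
  rw [Finset.sum_comm]
  refine Finset.sum_congr rfl fun h _ => ?_
  rw [sum_trajProb_mul_move hπ h fun s a s' => M.V θ h.castSucc s - M.r h s a - M.V θ h.succ s',
    ← sum_trajProb_mul_state h]
  refine Finset.sum_congr rfl fun x _ => ?_
  simp only [Q, mul_sub, Finset.sum_sub_distrib, ← Finset.sum_mul, (M.P_mem θ h _ _).2, mul_add,
    Finset.sum_add_distrib, one_mul]
  ring

theorem abs_value_sub_value_le (hπ : IsPolicy π) :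
    |M.value θ' π - M.value θ π| ≤ (H + 1) *
      ∑ x, M.trajProb θ π x * ∑ h : Fin H, ∑ s',
        |M.P θ' h (x.1 h.castSucc) (x.2 h) s' - M.P θ h (x.1 h.castSucc) (x.2 h) s'| := by
  refine le_trans ?_ (mul_le_mul_of_nonneg_left (sum_abs_trajProb_sub_param_le hπ) (by positivity))
  rw [value, value, ← Finset.sum_sub_distrib, Finset.mul_sum]
  refine (Finset.abs_sum_le_sum_abs _ _).trans (Finset.sum_le_sum fun x _ => ?_)
  rw [← sub_mul, abs_mul, mul_comm, abs_of_nonneg (M.totalReward_mem x).1]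
  exact mul_le_mul_of_nonneg_right (M.totalReward_mem x).2 (abs_nonneg _)

theorem abs_regret_le [Nonempty A] (hπ : IsPolicy π) : |M.regret θ π| ≤ H + 1 := by
  rw [regret]
  calc _ ≤ ∑ x, M.trajProb θ π x * (H + 1) := by
        refine (Finset.abs_sum_le_sum_abs _ _).trans (Finset.sum_le_sum fun x _ => ?_)
        rw [abs_mul, abs_of_nonneg (trajProb_nonneg hπ x)]
        refine mul_le_mul_of_nonneg_left ?_ (trajProb_nonneg hπ x)
        have h1 := M.V_mem (A := A) θ 0 (x.1 0)
        have h2 := M.totalReward_mem x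
        simp only [Fin.val_zero, Nat.cast_zero, sub_zero, Set.mem_Icc] at h1 h2
        rw [abs_le]
        constructor <;> linarith
    _ = _ := by rw [← Finset.sum_mul, sum_trajProb hπ, one_mul]

end Basic

/-! ### Optimal policies and the state-action pairs they use -/

section Optimal

variable {S A Θ : Type*} [Fintype S] [Fintype A] [MeasurableSpace Θ] {H : ℕ}
  {M : MDPFamily S A Θ H} {θ θ' : Θ} {π : Policy S A H} {Δ : ℝ}

/-- Testing optimality against the point mass at the gap action makes a sum of nonnegative terms `(Q
a - Q b) π b` nonpositive, so every term vanishes. -/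
theorem IsOptimal.exists_action (hπ : M.IsOptimal θ π) (hgap : M.HasGap Δ) (hΔ : 0 < Δ)
    {h : Fin H} {s : S} (hs : 0 < M.stateProb θ π h s) :
    ∃ a, π h s a = 1 ∧ (∀ b, b ≠ a → π h s b = 0) ∧ ∀ b, b ≠ a → M.Q θ h s b + Δ ≤ M.Q θ h s a := by
  classical
  obtain ⟨a, ha⟩ := hgap θ h s
  have hp := hπ.1 h s
  have h1 := hπ.2 h s hs _ (single_mem_stdSimplex ℝ a)
  have h2 : ∀ b, 0 ≤ (M.Q θ h s a - M.Q θ h s b) * π h s b := by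
    intro b
    by_cases hb : b = a
    · simp [hb]
    · exact mul_nonneg (by linarith [ha b hb]) (hp.1 b)
  have h3 : ∑ b, (M.Q θ h s a - M.Q θ h s b) * π h s b ≤ 0 := by
    simp only [sub_mul, Finset.sum_sub_distrib, ← Finset.mul_sum, hp.2]
    simpa [Pi.single_apply] using h1
  have h4 := (Finset.sum_eq_zero_iff_of_nonneg fun b _ => h2 b).1
    (h3.antisymm (Finset.sum_nonneg fun b _ => h2 b))
  have h5 : ∀ b, b ≠ a → π h s b = 0 := fun b hb =>
    (mul_eq_zero.1 (h4 b (Finset.mem_univ b))).resolve_left (by linarith [ha b hb])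
  refine ⟨a, ?_, h5, ha⟩
  rw [← hp.2, Finset.sum_eq_single a (fun b _ hb => h5 b hb) (by simp)]

theorem IsOptimal.regret_eq_zero (hπ : M.IsOptimal θ π) (hgap : M.HasGap Δ) (hΔ : 0 < Δ) :
    M.regret θ π = 0 := by
  rw [regret_eq_sum hπ.1]
  refine Finset.sum_eq_zero fun h _ => Finset.sum_eq_zero fun s _ => ?_
  rcases (stateProb_nonneg (M := M) (θ := θ) hπ.1 h s).eq_or_lt with h0 | h0
  · rw [← h0, zero_mul]
  obtain ⟨a, -, hb, hQ⟩ := hπ.exists_action hgap hΔ h0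
  have hV : M.V θ h.castSucc s = M.Q θ h s a := by
    have : Nonempty A := ⟨a⟩
    refine le_antisymm ?_ (M.Q_le_V θ h s a)
    rw [V_castSucc]
    refine ciSup_le fun b => ?_
    by_cases h1 : b = a
    · rw [h1]
    · linarith [hQ b h1]
  rw [Finset.sum_eq_zero, mul_zero]
  intro b _
  by_cases h1 : b = a
  · rw [h1, hV, sub_self, mul_zero]
  · rw [hb b h1, zero_mul]

/-- The period-state-action triples that `π` reaches with positive probability in `M(θ)`. -/
def reached (M : MDPFamily S A Θ H) (θ : Θ) (π : Policy S A H) : Set (Fin H × S × A) :=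
  {z | 0 < M.stateProb θ π z.1 z.2.1 * π z.1 z.2.1 z.2.2}

/-- The reached triples determine the action at every reached state. Since the total variation bound
averages along the policy of `θ` alone, agreement there makes both trajectory laws under `θ` equal;
unreached states do not matter. -/
theorem IsOptimal.regret_eq_zero_of_reached_eq {opt : Θ → Policy S A H}
    (hopt : ∀ θ, M.IsOptimal θ (opt θ)) (hgap : M.HasGap Δ) (hΔ : 0 < Δ)
    (h : M.reached θ (opt θ) = M.reached θ' (opt θ')) : M.regret θ (opt θ') = 0 := by
  rw [← (hopt θ).regret_eq_zero hgap hΔ]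
  have h1 : ∑ x, |M.trajProb θ (opt θ') x - M.trajProb θ (opt θ) x| ≤ 0 := by
    refine (sum_abs_trajProb_sub_policy_le (hopt θ).1 (hopt θ').1).trans (le_of_eq ?_)
    refine Finset.sum_eq_zero fun k _ => Finset.sum_eq_zero fun s _ => ?_
    rcases (stateProb_nonneg (M := M) (θ := θ) (hopt θ).1 k s).eq_or_lt with h0 | h0
    · rw [← h0, zero_mul]
    obtain ⟨a, ha, hb, -⟩ := (hopt θ).exists_action hgap hΔ h0
    have hmem : (k, s, a) ∈ M.reached θ' (opt θ') := by
      rw [← h]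
      simp only [reached, Set.mem_ofPred_eq, ha, mul_one, h0]
    have h2 := (hopt θ').1 k s
    have h3 := stateProb_nonneg (M := M) (θ := θ') (hopt θ').1 k s
    have h4 : 0 < M.stateProb θ' (opt θ') k s := by
      rcases h3.eq_or_lt with h5 | h5
      · simp [reached, ← h5] at hmem
      · exact h5
    obtain ⟨a', ha', hb', -⟩ := (hopt θ').exists_action hgap hΔ h4
    have haa : a = a' := by
      by_contra hne
      simp [reached, hb' a hne] at hmem
    subst haa
    rw [Finset.sum_eq_zero, mul_zero]
    intro b _
    by_cases hba : b = a
    · rw [hba, ha, ha', sub_self, abs_zero]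
    · rw [hb b hba, hb' b hba, sub_self, abs_zero]
  have h2 := (Finset.sum_eq_zero_iff_of_nonneg fun x _ => abs_nonneg _).1
    (h1.antisymm (Finset.sum_nonneg fun x _ => abs_nonneg _))
  refine Finset.sum_congr rfl fun x hx => ?_
  rw [sub_eq_zero.1 (abs_eq_zero.1 (h2 x hx))]

end Optimal

end MDPFamily

/-! ### Recovering the reached triples from the offline data -/

namespace MDPFamily

section Expert

variable {S A Θ : Type*} [Fintype S] [Fintype A] [MeasurableSpace Θ] {H : ℕ}
  {M : MDPFamily S A Θ H} {θ : Θ} {π : Policy S A H} {Δ β p δ : ℝ}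

theorem isPolicy_expert [Nonempty A] (M : MDPFamily S A Θ H) (β : ℝ) (θ : Θ) :
    IsPolicy (M.expert β θ) := by
  intro h s
  have h0 : 0 < ∑ b, Real.exp (β * M.Q θ h s b) :=
    Finset.sum_pos (fun b _ => Real.exp_pos _) Finset.univ_nonempty
  refine ⟨fun a => div_nonneg (Real.exp_pos _).le h0.le, ?_⟩
  simp only [expert]
  rw [← Finset.sum_div, div_self h0.ne']

/-- Keep only the term of the better action `a` in the softmax normalizer. -/
theorem expert_le_exp (hβ : 0 ≤ β) {h : Fin H} {s : S} {a b : A}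
    (hab : M.Q θ h s b + Δ ≤ M.Q θ h s a) : M.expert β θ h s b ≤ Real.exp (-(β * Δ)) := by
  rw [expert, div_le_iff₀ (Finset.sum_pos (fun c _ => Real.exp_pos _) ⟨a, Finset.mem_univ a⟩)]
  refine le_trans ?_ (mul_le_mul_of_nonneg_left
    (Finset.single_le_sum (fun c _ => (Real.exp_pos (β * M.Q θ h s c)).le) (Finset.mem_univ a))
    (Real.exp_pos _).le)
  rw [← Real.exp_add, Real.exp_le_exp]
  nlinarith

theorem sum_stateProb (hπ : IsPolicy π) (h : Fin H) : ∑ s, M.stateProb θ π h s = 1 := by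
  rw [← sum_trajProb (M := M) (θ := θ) hπ]
  simpa using (sum_trajProb_mul_state (M := M) (θ := θ) (π := π) h fun _ => 1).symm

/-- At a reached state the optimal policy is a point mass, so the `ℓ¹` distance to the expert is
twice the expert's mass on inferior actions. The state probabilities of each period sum to one,
which leaves a factor `H` and no factor for the number of states. -/
theorem IsOptimal.sum_abs_trajProb_expert_sub_le [Nonempty A] (hπ : M.IsOptimal θ π)
    (hgap : M.HasGap Δ) (hΔ : 0 < Δ) (hβ : 0 ≤ β) :
    ∑ x, |M.trajProb θ (M.expert β θ) x - M.trajProb θ π x| ≤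
      2 * H * Fintype.card A * Real.exp (-(β * Δ)) := by
  classical
  have hE := isPolicy_expert M β θ
  refine (sum_abs_trajProb_sub_policy_le hπ.1 hE).trans ?_
  have key : ∀ h s, M.stateProb θ π h s * ∑ a, |M.expert β θ h s a - π h s a| ≤
      M.stateProb θ π h s * (2 * Fintype.card A * Real.exp (-(β * Δ))) := by
    intro h s
    have hs := stateProb_nonneg (M := M) (θ := θ) hπ.1 h s
    rcases hs.eq_or_lt with h0 | h0
    · rw [← h0, zero_mul, zero_mul]
    refine mul_le_mul_of_nonneg_left ?_ hs
    obtain ⟨a, ha, hb, hQ⟩ := hπ.exists_action hgap hΔ h0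
    have h1 : ∑ b ∈ Finset.univ.erase a, M.expert β θ h s b ≤
        Fintype.card A * Real.exp (-(β * Δ)) := by
      refine (Finset.sum_le_card_nsmul _ _ (Real.exp (-(β * Δ))) fun b hb =>
        expert_le_exp hβ (hQ b (Finset.ne_of_mem_erase hb))).trans ?_
      rw [nsmul_eq_mul]
      exact mul_le_mul_of_nonneg_right (by exact_mod_cast Finset.card_le_univ _)
        (Real.exp_pos _).le
    have h2 : ∑ b ∈ Finset.univ.erase a, |M.expert β θ h s b - π h s b| =
        ∑ b ∈ Finset.univ.erase a, M.expert β θ h s b :=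
      Finset.sum_congr rfl fun b hb' => by
        rw [hb b (Finset.ne_of_mem_erase hb'), sub_zero, abs_of_nonneg ((hE h s).1 b)]
    have h3 := Finset.add_sum_erase Finset.univ (M.expert β θ h s) (Finset.mem_univ a)
    rw [(hE h s).2] at h3
    rw [← Finset.add_sum_erase _ _ (Finset.mem_univ a), h2, ha,
      abs_of_nonpos (sub_nonpos.2 (le_one_of_mem_stdSimplex (hE h s) a))]
    linarith
  refine (Finset.sum_le_sum fun h _ => Finset.sum_le_sum fun s _ => key h s).trans (le_of_eq ?_)
  simp only [← Finset.sum_mul, sum_stateProb hπ.1]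
  simp
  ring

open Classical in
/-- Indicator of the event that an episode visits the triple `z`. -/
def visit (z : Fin H × S × A) (x : Traj S A H) : ℝ :=
  if x.1 z.1.castSucc = z.2.1 ∧ x.2 z.1 = z.2.2 then 1 else 0

open Classical in
/-- Indicator of the event that an episode visits a triple outside `F`. -/
def leaves (F : Set (Fin H × S × A)) (x : Traj S A H) : ℝ :=
  if ∀ h, (h, x.1 h.castSucc, x.2 h) ∈ F then 0 else 1

theorem sum_trajProb_mul_visit (hπ : IsPolicy π) (z : Fin H × S × A) :
    ∑ x, M.trajProb θ π x * visit z x = M.stateProb θ π z.1 z.2.1 * π z.1 z.2.1 z.2.2 := by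
  classical
  rw [show (fun x : Traj S A H => M.trajProb θ π x * visit z x) = fun x => M.trajProb θ π x *
    (fun s a => if s = z.2.1 ∧ a = z.2.2 then (1 : ℝ) else 0) (x.1 z.1.castSucc) (x.2 z.1) from by
      funext x; simp only [visit]]
  rw [sum_trajProb_mul_action hπ z.1 fun s a => if s = z.2.1 ∧ a = z.2.2 then (1 : ℝ) else 0]
  rw [Finset.sum_eq_single z.2.1 (fun s _ hs => by simp [hs]) (by simp)]
  simp

theorem sum_trajProb_mul_leaves (hπ : IsPolicy π) :
    ∑ x, M.trajProb θ π x * leaves (M.reached θ π) x = 0 := by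
  classical
  refine Finset.sum_eq_zero fun x _ => ?_
  rcases (trajProb_nonneg (M := M) (θ := θ) hπ x).eq_or_lt with h0 | h0
  · rw [← h0, zero_mul]
  rw [leaves, if_pos, mul_zero]
  intro h
  have h1 : M.trajProb θ π x * visit (h, x.1 h.castSucc, x.2 h) x ≤
      ∑ y, M.trajProb θ π y * visit (h, x.1 h.castSucc, x.2 h) y :=
    Finset.single_le_sum (f := fun y => M.trajProb θ π y * visit (h, x.1 h.castSucc, x.2 h) y)
      (fun y _ => mul_nonneg (trajProb_nonneg hπ y) (by unfold visit; split_ifs <;> norm_num))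
      (Finset.mem_univ x)
  rw [sum_trajProb_mul_visit hπ, visit, if_pos ⟨rfl, rfl⟩, mul_one] at h1
  exact h0.trans_le h1

theorem abs_sum_mul_sub_sum_mul_le {ι : Type*} [Fintype ι] (q q' f : ι → ℝ)
    (hf : ∀ i, |f i| ≤ 1) : |∑ i, q' i * f i - ∑ i, q i * f i| ≤ ∑ i, |q' i - q i| := by
  rw [← Finset.sum_sub_distrib]
  refine (Finset.abs_sum_le_sum_abs _ _).trans (Finset.sum_le_sum fun i _ => ?_)
  rw [← sub_mul, abs_mul]
  exact mul_le_of_le_one_right (abs_nonneg _) (hf i)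

/-- The triples visited in at least `L p / 2` of the `L` episodes `d`. -/
def frequent (p : ℝ) {L : ℕ} (d : Fin L → Traj S A H) : Set (Fin H × S × A) :=
  {z | L * p / 2 ≤ ∑ l, visit z (d l)}

/-- Independence of the offline episodes, in the form used for exponential moments. -/
theorem sum_offlineProb_mul_exp {L : ℕ} (f : Traj S A H → ℝ) :
    ∑ d : Fin L → Traj S A H, M.offlineProb β θ d * Real.exp (∑ l, f (d l)) =
      (∑ x, M.trajProb θ (M.expert β θ) x * Real.exp (f x)) ^ L := by
  rw [Fintype.sum_pow]
  simp only [offlineProb, Real.exp_sum, Finset.prod_mul_distrib]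

omit [Fintype S] [Fintype A] in
theorem visit_mem (z : Fin H × S × A) (x : Traj S A H) : visit z x = 0 ∨ visit z x = 1 := by
  unfold visit
  split_ifs <;> simp

omit [Fintype S] [Fintype A] in
theorem leaves_mem (F : Set (Fin H × S × A)) (x : Traj S A H) :
    leaves F x = 0 ∨ leaves F x = 1 := by
  unfold leaves
  split_ifs <;> simp

/-- For a 0-1 variable `exp (l f) = 1 + (exp l - 1) f`; then use `1 + x ≤ exp x`. The shift `c`
carries the Chernoff threshold, spread evenly over the episodes. -/
theorem exp_bernoulli_le {ι : Type*} [Fintype ι] {q f : ι → ℝ} (hq : ∑ i, q i = 1)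
    (hf : ∀ i, f i = 0 ∨ f i = 1) (l c : ℝ) :
    ∑ i, q i * Real.exp (l * f i + c) ≤
      Real.exp (c + (Real.exp l - 1) * ∑ i, q i * f i) := by
  have h1 : ∀ i, q i * Real.exp (l * f i + c) =
      Real.exp c * (q i + (Real.exp l - 1) * (q i * f i)) := by
    intro i
    rcases hf i with h | h <;> simp [h, Real.exp_add] <;> ring
  simp only [h1, ← Finset.mul_sum, Finset.sum_add_distrib, hq, Real.exp_add c]
  refine mul_le_mul_of_nonneg_left ?_ (Real.exp_pos _).le
  linarith [Real.add_one_le_exp ((Real.exp l - 1) * ∑ i, q i * f i)]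

open Classical in
/-- Chernoff bound: the frequent triples of the offline data are exactly the reached ones, up to an
exponentially small probability. -/
theorem IsOptimal.sum_offlineProb_frequent_ne_le [Nonempty A] (hπ : M.IsOptimal θ π)
    (hgap : M.HasGap Δ) (hΔ : 0 < Δ) (hβ : 0 ≤ β)
    (hp : ∀ h s, 0 < M.stateProb θ π h s → p ≤ M.stateProb θ π h s) (hp0 : 0 < p)
    (hβp : 2 * H * Fintype.card A * Real.exp (-(β * Δ)) ≤ p / 10) (L : ℕ) :
    ∑ d : Fin L → Traj S A H, M.offlineProb β θ d *
        (if M.reached θ π = frequent p d then 0 else 1) ≤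
      (H * Fintype.card S + 1) * Real.exp (-(L * p / 18)) := by
  have hE := isPolicy_expert M β θ
  have hq0 : ∀ d : Fin L → Traj S A H, 0 ≤ M.offlineProb β θ d := fun d =>
    Finset.prod_nonneg fun l _ => trajProb_nonneg hE _
  have htv := (hπ.sum_abs_trajProb_expert_sub_le hgap hΔ hβ).trans hβp
  set R := M.reached θ π with hR
  have hleave : ∑ x, M.trajProb θ (M.expert β θ) x * leaves R x ≤ p / 10 := by
    have h1 := abs_sum_mul_sub_sum_mul_le (M.trajProb θ π) (M.trajProb θ (M.expert β θ))
      (leaves R) fun x => by rcases leaves_mem R x with h | h <;> simp [h]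
    rw [hR, sum_trajProb_mul_leaves hπ.1, ← hR, sub_zero] at h1
    exact (le_abs_self _).trans (h1.trans htv)
  have hvisit : ∀ z ∈ R, 9 * p / 10 ≤ ∑ x, M.trajProb θ (M.expert β θ) x * visit z x := by
    intro z hz
    have h1 := abs_sum_mul_sub_sum_mul_le (M.trajProb θ π) (M.trajProb θ (M.expert β θ))
      (visit z) fun x => by rcases visit_mem z x with h | h <;> simp [h]
    rw [sum_trajProb_mul_visit hπ.1] at h1
    have hz' : 0 < M.stateProb θ π z.1 z.2.1 * π z.1 z.2.1 z.2.2 := hz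
    have h2 : 0 < M.stateProb θ π z.1 z.2.1 :=
      pos_of_mul_pos_left hz' ((hπ.1 _ _).1 _)
    obtain ⟨a, ha, hb, -⟩ := hπ.exists_action hgap hΔ h2
    have h3 : z.2.2 = a := by
      by_contra hne
      simp [hb _ hne] at hz'
    rw [h3, ha, mul_one] at h1
    have h4 := neg_le_of_abs_le (h1.trans htv)
    linarith [hp _ _ h2]
  have hterm : ∀ (f : Traj S A H → ℝ), ∑ x, M.trajProb θ (M.expert β θ) x * Real.exp (f x) ≤
      Real.exp (-(p / 18)) → ∑ d : Fin L → Traj S A H, M.offlineProb β θ d *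
        Real.exp (∑ l, f (d l)) ≤ Real.exp (-(L * p / 18)) := by
    intro f hf
    rw [sum_offlineProb_mul_exp]
    refine (pow_le_pow_left₀ (Finset.sum_nonneg fun x _ => mul_nonneg (trajProb_nonneg hE x)
      (Real.exp_pos _).le) hf L).trans (le_of_eq ?_)
    rw [← Real.exp_nat_mul]
    ring_nf
  -- The exponent is at most `-p / 2 + (e - 1) p / 10`, well below `-p / 18`.
  have hA := hterm (fun x => 1 * leaves R x + -(p / 2)) <| by
    refine (exp_bernoulli_le (sum_trajProb hE) (leaves_mem R) 1 (-(p / 2))).trans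
      (Real.exp_le_exp.2 ?_)
    have h1 := Real.exp_one_lt_d9
    have h2 := Real.exp_one_gt_d9
    nlinarith
  -- Here the rate `1 / 18` is nearly attained: with `exp (-1/2) ≤ 0.66` the exponent is at most `p
  -- / 4 - 0.34 * 0.9 * p = -0.056 p`.
  have hB : ∀ z ∈ R, ∑ d : Fin L → Traj S A H, M.offlineProb β θ d *
      Real.exp (∑ l, ((-(1 / 2)) * visit z (d l) + p / 4)) ≤ Real.exp (-(L * p / 18)) := by
    intro z hz
    refine hterm (fun x => (-(1 / 2)) * visit z x + p / 4) ?_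
    refine (exp_bernoulli_le (sum_trajProb hE) (visit_mem z) (-(1 / 2)) (p / 4)).trans
      (Real.exp_le_exp.2 ?_)
    have h1 : Real.exp (-(1 / 2)) ≤ 0.66 := by
      have h3 := Real.quadratic_le_exp_of_nonneg (show (0 : ℝ) ≤ 1 / 2 by norm_num)
      rw [Real.exp_neg, inv_le_comm₀ (Real.exp_pos _) (by norm_num)]
      norm_num at h3 ⊢
      linarith
    nlinarith [hvisit z hz]
  -- Each reached state has one optimal action, so the union bound involves no factor for the number
  -- of actions.
  have hcard : (Finset.univ.filter fun z => z ∈ R).card ≤ H * Fintype.card S := by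
    have : H * Fintype.card S = (Finset.univ : Finset (Fin H × S)).card := by simp
    rw [this]
    refine Finset.card_le_card_of_injOn (fun z => (z.1, z.2.1)) (fun _ _ => by simp) ?_
    intro z hz z' hz' h
    simp only [Finset.coe_filter, Finset.mem_univ, true_and] at hz hz'
    obtain ⟨k, s, a⟩ := z
    obtain ⟨k', s', a'⟩ := z'
    simp only [Prod.mk.injEq] at h
    obtain ⟨rfl, rfl⟩ := h
    have hz1 : 0 < M.stateProb θ π k s * π k s a := hz
    have hz2 : 0 < M.stateProb θ π k s * π k s a' := hz'
    obtain ⟨b, -, hb, -⟩ := hπ.exists_action hgap hΔ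
      (pos_of_mul_pos_left hz1 ((hπ.1 _ _).1 _))
    have e1 : a = b := by
      by_contra hne
      simp [hb _ hne] at hz1
    have e2 : a' = b := by
      by_contra hne
      simp [hb _ hne] at hz2
    rw [e1, e2]
  have hpt : ∀ d : Fin L → Traj S A H, (if R = frequent p d then (0 : ℝ) else 1) ≤
      Real.exp (∑ l, (1 * leaves R (d l) + -(p / 2))) +
        ∑ z ∈ Finset.univ.filter fun z => z ∈ R,
          Real.exp (∑ l, ((-(1 / 2)) * visit z (d l) + p / 4)) := by
    intro d
    have n1 := (Real.exp_pos (∑ l, (1 * leaves R (d l) + -(p / 2)))).le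
    have n2 : ∀ z : Fin H × S × A,
        0 ≤ Real.exp (∑ l, ((-(1 / 2)) * visit z (d l) + p / 4)) :=
      fun z => (Real.exp_pos _).le
    split_ifs with h
    · exact add_nonneg n1 (Finset.sum_nonneg fun z _ => n2 z)
    obtain ⟨z, hz⟩ : ∃ z, ¬ (z ∈ R ↔ z ∈ frequent p d) := by
      by_contra hcon
      push Not at hcon
      exact h (Set.ext hcon)
    by_cases hzR : z ∈ R
    · have h1 : ¬ (L * p / 2 ≤ ∑ l, visit z (d l)) := fun h => hz ⟨fun _ => h, fun _ => hzR⟩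
      have h2 : 1 ≤ Real.exp (∑ l, ((-(1 / 2)) * visit z (d l) + p / 4)) := by
        refine Real.one_le_exp ?_
        rw [Finset.sum_add_distrib, ← Finset.mul_sum]
        simp only [Finset.sum_const, Finset.card_univ, Fintype.card_fin, nsmul_eq_mul]
        linarith
      have h3 := Finset.single_le_sum (s := Finset.univ.filter fun z => z ∈ R)
        (fun z _ => n2 z) (Finset.mem_filter.2 ⟨Finset.mem_univ z, hzR⟩)
      linarith
    -- Every visit to a triple outside `R` is a departure from `R`. One event therefore covers all
    -- unreached triples and contributes the single `+ 1` of the bound.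
    · have h1 : L * p / 2 ≤ ∑ l, visit z (d l) := by
        by_contra h1
        exact hz ⟨fun h => absurd h hzR, fun h => absurd h h1⟩
      have h2 : ∑ l, visit z (d l) ≤ ∑ l, leaves R (d l) := by
        refine Finset.sum_le_sum fun l _ => ?_
        unfold visit leaves
        split_ifs with c1 c2
        · refine absurd (c2 z.1) ?_
          rw [c1.1, c1.2]
          exact hzR
        all_goals norm_num
      have h3 : 1 ≤ Real.exp (∑ l, (1 * leaves R (d l) + -(p / 2))) := by
        refine Real.one_le_exp ?_
        rw [Finset.sum_add_distrib, ← Finset.mul_sum]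
        simp only [Finset.sum_const, Finset.card_univ, Fintype.card_fin, nsmul_eq_mul]
        linarith
      have := Finset.sum_nonneg (s := Finset.univ.filter fun z => z ∈ R) fun z _ => n2 z
      linarith
  calc _ ≤ ∑ d : Fin L → Traj S A H, M.offlineProb β θ d *
        (Real.exp (∑ l, (1 * leaves R (d l) + -(p / 2))) +
        ∑ z ∈ Finset.univ.filter fun z => z ∈ R,
          Real.exp (∑ l, ((-(1 / 2)) * visit z (d l) + p / 4))) :=
        Finset.sum_le_sum fun d _ => mul_le_mul_of_nonneg_left (hpt d) (hq0 d)
    _ = ∑ d : Fin L → Traj S A H, M.offlineProb β θ d *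
          Real.exp (∑ l, (1 * leaves R (d l) + -(p / 2))) +
        ∑ z ∈ Finset.univ.filter fun z => z ∈ R, ∑ d : Fin L → Traj S A H,
          M.offlineProb β θ d * Real.exp (∑ l, ((-(1 / 2)) * visit z (d l) + p / 4)) := by
        simp only [mul_add, Finset.sum_add_distrib, Finset.mul_sum]
        rw [Finset.sum_comm]
    _ ≤ Real.exp (-(L * p / 18)) + ∑ z ∈ Finset.univ.filter fun z => z ∈ R,
          Real.exp (-(L * p / 18)) :=
        add_le_add hA (Finset.sum_le_sum fun z hz => hB z (Finset.mem_filter.1 hz).2)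
    _ ≤ _ := by
        rw [Finset.sum_const, nsmul_eq_mul, add_mul, one_mul, add_comm]
        gcongr
        exact_mod_cast hcard

end Expert

end MDPFamily

/-! ### Bounded measurable functions -/

/-- `f` is measurable and bounded. -/
structure BddMeas {X : Type*} [MeasurableSpace X] (f : X → ℝ) : Prop where
  measurable : Measurable f
  bdd : ∃ C, ∀ x, |f x| ≤ C

namespace BddMeas

variable {X Y : Type*} [MeasurableSpace X] [MeasurableSpace Y] {f g : X → ℝ}

theorem const (c : ℝ) : BddMeas fun _ : X => c := ⟨measurable_const, |c|, fun _ => le_rfl⟩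

theorem add (hf : BddMeas f) (hg : BddMeas g) : BddMeas fun x => f x + g x := by
  obtain ⟨C, hC⟩ := hf.bdd
  obtain ⟨D, hD⟩ := hg.bdd
  exact ⟨hf.measurable.add hg.measurable, C + D,
    fun x => (abs_add_le _ _).trans (add_le_add (hC x) (hD x))⟩

theorem mul (hf : BddMeas f) (hg : BddMeas g) : BddMeas fun x => f x * g x := by
  obtain ⟨C, hC⟩ := hf.bdd
  obtain ⟨D, hD⟩ := hg.bdd
  refine ⟨hf.measurable.mul hg.measurable, C * D, fun x => ?_⟩
  rw [abs_mul]
  exact mul_le_mul (hC x) (hD x) (abs_nonneg _) ((abs_nonneg _).trans (hC x))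

theorem const_mul (hf : BddMeas f) (c : ℝ) : BddMeas fun x => c * f x := (const c).mul hf

theorem sub (hf : BddMeas f) (hg : BddMeas g) : BddMeas fun x => f x - g x := by
  simpa only [sub_eq_add_neg, neg_one_mul] using hf.add (hg.const_mul (-1))

theorem abs (hf : BddMeas f) : BddMeas fun x => |f x| :=
  ⟨hf.measurable.norm, hf.bdd.imp fun C hC x => by rw [abs_abs]; exact hC x⟩

theorem sum {ι : Type*} (s : Finset ι) {f : ι → X → ℝ} (hf : ∀ i, BddMeas (f i)) :
    BddMeas fun x => ∑ i ∈ s, f i x := by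
  classical
  induction s using Finset.induction_on with
  | empty => simpa using const 0
  | insert i s hi ih => simpa only [Finset.sum_insert hi] using (hf i).add ih

theorem prod {ι : Type*} (s : Finset ι) {f : ι → X → ℝ} (hf : ∀ i, BddMeas (f i)) :
    BddMeas fun x => ∏ i ∈ s, f i x := by
  classical
  induction s using Finset.induction_on with
  | empty => simpa using const 1
  | insert i s hi ih => simpa only [Finset.prod_insert hi] using (hf i).mul ih

theorem comp (hf : BddMeas f) {φ : Y → X} (hφ : Measurable φ) : BddMeas fun y => f (φ y) :=
  ⟨hf.measurable.comp hφ, hf.bdd.imp fun _ hC y => hC (φ y)⟩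

theorem integrable (hf : BddMeas f) (μ : Measure X) [IsFiniteMeasure μ] : Integrable f μ := by
  obtain ⟨C, hC⟩ := hf.bdd
  exact Integrable.of_bound hf.measurable.aestronglyMeasurable C (Filter.Eventually.of_forall hC)

theorem of_mem_Icc (hf : Measurable f) {a b : ℝ} (h : ∀ x, f x ∈ Set.Icc a b) : BddMeas f :=
  ⟨hf, max |a| |b|, fun x => abs_le_max_abs_abs (h x).1 (h x).2⟩

end BddMeas

namespace MDPFamily

/-! ### Measurability in the parameter -/

section Measurability

variable {S A Θ : Type*} [Fintype S] [Fintype A] [MeasurableSpace Θ] {H : ℕ}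
  (M : MDPFamily S A Θ H)

theorem measurable_V (h : Fin (H + 1)) (s : S) : Measurable fun θ => M.V θ h s := by
  induction h using Fin.reverseInduction generalizing s with
  | last => simp only [V_last, measurable_const]
  | cast h ih =>
    simp only [V_castSucc, Q]
    exact Measurable.iSup fun a => measurable_const.add
      (Finset.measurable_sum _ fun s' _ => (M.P_measurable h s a s').mul (ih s'))

theorem measurable_Q (h : Fin H) (s : S) (a : A) : Measurable fun θ => M.Q θ h s a :=
  measurable_const.add
    (Finset.measurable_sum _ fun s' _ => (M.P_measurable h s a s').mul (M.measurable_V h.succ s'))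

omit [Fintype A] in
theorem bddMeas_P (h : Fin H) (s : S) (a : A) (s' : S) : BddMeas fun θ => M.P θ h s a s' :=
  .of_mem_Icc (M.P_measurable h s a s')
    fun θ => ⟨(M.P_mem θ h s a).1 s', le_one_of_mem_stdSimplex (M.P_mem θ h s a) s'⟩

omit [Fintype A] in
theorem bddMeas_transLik (x : Traj S A H) : BddMeas fun θ => M.transLik θ x :=
  (BddMeas.const _).mul (.prod _ fun _ => M.bddMeas_P _ _ _ _)

omit [Fintype S] in
theorem bddMeas_actLik {Λ : Type*} [MeasurableSpace Λ] {π : Λ → Policy S A H}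
    (hπ : ∀ θ, IsPolicy (π θ)) (hm : ∀ h s a, Measurable fun θ => π θ h s a) (x : Traj S A H) :
    BddMeas fun θ => actLik (π θ) x :=
  .prod _ fun h => .of_mem_Icc (hm h _ _)
    fun θ => ⟨(hπ θ h _).1 _, le_one_of_mem_stdSimplex (hπ θ h _) _⟩

theorem measurable_expert (β : ℝ) (h : Fin H) (s : S) (a : A) :
    Measurable fun θ => M.expert β θ h s a := by
  simp only [expert]
  exact ((M.measurable_Q h s a).const_mul β).exp.div
    (Finset.measurable_sum _ fun b _ => ((M.measurable_Q h s b).const_mul β).exp)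

theorem bddMeas_offlineProb [Nonempty A] (β : ℝ) {L : ℕ} (d : Fin L → Traj S A H) :
    BddMeas fun θ => M.offlineProb β θ d := by
  simp only [offlineProb, trajProb_eq_mul]
  exact .prod _ fun l => (M.bddMeas_transLik _).mul
    (bddMeas_actLik (M.isPolicy_expert β) (M.measurable_expert β) _)

theorem bddMeas_V [Nonempty A] (h : Fin (H + 1)) (s : S) : BddMeas fun θ => M.V θ h s :=
  .of_mem_Icc (M.measurable_V h s) fun θ => M.V_mem θ h s

end Measurability

/-! ### Expectations over runs of posterior sampling -/

section Expect

variable {S A Θ : Type*} [Fintype S] [Fintype A] [MeasurableSpace Θ] {H : ℕ}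
  (M : MDPFamily S A Θ H) (opt : Θ → Policy S A H) (μ₀ : Measure Θ) (β : ℝ) {L : ℕ}

/-- The likelihood of `θ` given the offline data `d` and the online episodes `τ`. -/
def dataLik {T : ℕ} (d : Fin L → Traj S A H) (τ : Fin T → Traj S A H) (θ : Θ) : ℝ :=
  M.offlineProb β θ d * ∏ j, M.transLik θ (τ j)

/-- The marginal likelihood of the data under the prior. -/
def evidence {T : ℕ} (d : Fin L → Traj S A H) (τ : Fin T → Traj S A H) : ℝ :=
  ∫ θ, M.dataLik β d τ θ ∂μ₀

/-- The factor of the conditional probability of the next episode `x` that is due to the agent. -/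
def actProb {T : ℕ} (d : Fin L → Traj S A H) (τ : Fin T → Traj S A H) (x : Traj S A H) : ℝ :=
  (M.evidence μ₀ β d τ)⁻¹ * ∫ θ, M.dataLik β d τ θ * actLik (opt θ) x ∂μ₀

/-- The factor of the probability of the online episodes that is due to the agent. -/
def agentLik {T : ℕ} (d : Fin L → Traj S A H) (τ : Fin T → Traj S A H) : ℝ :=
  ∏ t : Fin T, M.actProb opt μ₀ β d (fun j : Fin t => τ (j.castLE t.2.le)) (τ t)

/-- The expectation of a function of the parameter, the offline data and `T` online episodes. -/
def expect {T : ℕ} (Φ : Θ → (Fin L → Traj S A H) → (Fin T → Traj S A H) → ℝ) : ℝ :=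
  ∑ d, ∑ τ, M.agentLik opt μ₀ β d τ * ∫ θ, M.dataLik β d τ θ * Φ θ d τ ∂μ₀

/-- The expectation of a function of the true parameter `z.1`, the posterior sample `z.2`, the
offline data and `T` online episodes. -/
def expectPair {T : ℕ} (f : Θ × Θ → (Fin L → Traj S A H) → (Fin T → Traj S A H) → ℝ) : ℝ :=
  ∑ d, ∑ τ, M.agentLik opt μ₀ β d τ * ((M.evidence μ₀ β d τ)⁻¹ *
    ∫ z, M.dataLik β d τ z.1 * M.dataLik β d τ z.2 * f z d τ ∂(μ₀.prod μ₀))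

variable {M opt μ₀ β} [Nonempty A]

theorem bddMeas_dataLik {T : ℕ} (d : Fin L → Traj S A H) (τ : Fin T → Traj S A H) :
    BddMeas fun θ => M.dataLik β d τ θ :=
  (M.bddMeas_offlineProb β d).mul (.prod _ fun _ => M.bddMeas_transLik _)

theorem offlineProb_nonneg (θ : Θ) (d : Fin L → Traj S A H) : 0 ≤ M.offlineProb β θ d :=
  Finset.prod_nonneg fun _ _ => trajProb_nonneg (M.isPolicy_expert β θ) _

theorem dataLik_nonneg {T : ℕ} (d : Fin L → Traj S A H) (τ : Fin T → Traj S A H) (θ : Θ) :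
    0 ≤ M.dataLik β d τ θ :=
  mul_nonneg (offlineProb_nonneg θ d) (Finset.prod_nonneg fun _ _ => (M.transLik_mem θ _).1)

theorem evidence_nonneg {T : ℕ} (d : Fin L → Traj S A H) (τ : Fin T → Traj S A H) :
    0 ≤ M.evidence μ₀ β d τ :=
  integral_nonneg fun θ => dataLik_nonneg d τ θ

theorem agentLik_nonneg (hopt : ∀ θ, IsPolicy (opt θ)) {T : ℕ} (d : Fin L → Traj S A H)
    (τ : Fin T → Traj S A H) : 0 ≤ M.agentLik opt μ₀ β d τ :=
  Finset.prod_nonneg fun _ _ => mul_nonneg (inv_nonneg.2 (evidence_nonneg _ _))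
    (integral_nonneg fun θ => mul_nonneg (dataLik_nonneg _ _ θ) (actLik_mem (hopt θ) _).1)

omit [Fintype A] [Nonempty A] in
theorem snoc_castLE {X : Type*} {T : ℕ} (τ : Fin T → X) (x : X) {t : ℕ} (h : t ≤ T)
    (h' : t ≤ T + 1) (j : Fin t) :
    (Fin.snoc τ x : Fin (T + 1) → X) (j.castLE h') = τ (j.castLE h) :=
  Fin.snoc_castSucc (α := fun _ => X) x τ (j.castLE h)

omit [Nonempty A] in
theorem agentLik_snoc {T : ℕ} (d : Fin L → Traj S A H) (τ : Fin T → Traj S A H)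
    (x : Traj S A H) :
    M.agentLik opt μ₀ β d (Fin.snoc τ x : Fin (T + 1) → Traj S A H) =
      M.agentLik opt μ₀ β d τ * M.actProb opt μ₀ β d τ x := by
  rw [agentLik, Fin.prod_univ_castSucc, agentLik]
  congr 1
  · refine Finset.prod_congr rfl fun t _ => ?_
    rw [Fin.snoc_castSucc]
    congr 1
    funext j
    exact snoc_castLE τ x t.2.le _ j
  · rw [Fin.snoc_last]
    congr 1
    funext j
    exact snoc_castLE τ x le_rfl _ j

omit [Nonempty A] in
theorem dataLik_snoc {T : ℕ} (d : Fin L → Traj S A H) (τ : Fin T → Traj S A H)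
    (x : Traj S A H) (θ : Θ) :
    M.dataLik β d (Fin.snoc τ x : Fin (T + 1) → Traj S A H) θ =
      M.dataLik β d τ θ * M.transLik θ x := by
  simp only [dataLik, Fin.prod_univ_castSucc, Fin.snoc_castSucc, Fin.snoc_last, mul_assoc]

-- The posterior inside a run of `T` episodes is that of the truncated run of length `t`, which
-- opens the way to induction on the number of episodes.
omit [Nonempty A] in
theorem likelihood_eq_dataLik {T : ℕ} (d : Fin L → Traj S A H) (τ : Fin T → Traj S A H)
    (t : Fin T) (θ : Θ) :
    M.likelihood β d τ t θ = M.dataLik β d (fun j : Fin t => τ (j.castLE t.2.le)) θ := by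
  rw [likelihood, dataLik]
  congr 1
  symm
  refine Finset.prod_bij (fun j _ => j.castLE t.2.le) (fun j _ => ?_) (fun i _ j _ h => ?_)
    (fun j hj => ?_) (fun j _ => rfl)
  · rw [Finset.mem_Iio, Fin.lt_def]
    exact j.2
  · exact Fin.castLE_injective _ h
  · rw [Finset.mem_Iio, Fin.lt_def] at hj
    exact ⟨⟨j, hj⟩, Finset.mem_univ _, rfl⟩

theorem integral_posterior [IsProbabilityMeasure μ₀] {T : ℕ} (d : Fin L → Traj S A H)
    (τ : Fin T → Traj S A H) (t : Fin T) (f : Θ → ℝ) :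
    ∫ θ, f θ ∂(M.posterior μ₀ β d τ t) =
      (M.evidence μ₀ β d (fun j : Fin t => τ (j.castLE t.2.le)))⁻¹ *
        ∫ θ, M.dataLik β d (fun j : Fin t => τ (j.castLE t.2.le)) θ * f θ ∂μ₀ := by
  have hb := bddMeas_dataLik (M := M) (β := β) d (fun j : Fin t => τ (j.castLE t.2.le))
  have h0 := dataLik_nonneg (M := M) (β := β) d (fun j : Fin t => τ (j.castLE t.2.le))
  simp only [posterior, likelihood_eq_dataLik]
  rw [integral_smul_measure, integral_withDensity_eq_integral_toReal_smul
    hb.measurable.ennreal_ofReal (Filter.Eventually.of_forall fun _ => ENNReal.ofReal_lt_top),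
    ← ofReal_integral_eq_lintegral_ofReal (hb.integrable μ₀) (Filter.Eventually.of_forall h0),
    ENNReal.toReal_inv, ENNReal.toReal_ofReal (integral_nonneg h0)]
  simp only [ENNReal.toReal_ofReal (h0 _), smul_eq_mul]
  rfl

/-- The agent sees the parameter only through the data, so its factor leaves the integral over `θ`.
-/
theorem runProb_eq [IsProbabilityMeasure μ₀] {T : ℕ} (θ : Θ) (d : Fin L → Traj S A H)
    (τ : Fin T → Traj S A H) :
    M.runProb opt μ₀ β θ d τ = M.agentLik opt μ₀ β d τ * M.dataLik β d τ θ := by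
  have h1 : ∀ t, M.episodeProb opt μ₀ β θ d τ t = M.transLik θ (τ t) *
      M.actProb opt μ₀ β d (fun j : Fin t => τ (j.castLE t.2.le)) (τ t) := by
    intro t
    rw [episodeProb, integral_posterior, actProb]
    simp only [trajProb_eq_mul, mul_left_comm _ (M.transLik θ (τ t)), integral_const_mul]
  simp only [runProb, h1, Finset.prod_mul_distrib, agentLik, dataLik]
  ring

theorem bayesRegret_eq_expect [IsProbabilityMeasure μ₀] {T : ℕ} :
    M.bayesRegret opt μ₀ β L T = M.expect opt μ₀ β (L := L) (T := T) fun θ _ τ =>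
      ∑ t, (M.V θ 0 ((τ t).1 0) - M.totalReward (τ t)) := by
  have hb : ∀ (d : Fin L → Traj S A H) (τ : Fin T → Traj S A H), BddMeas fun θ =>
      M.runProb opt μ₀ β θ d τ * ∑ t, (M.V θ 0 ((τ t).1 0) - M.totalReward (τ t)) := by
    intro d τ
    simp only [runProb_eq]
    exact ((bddMeas_dataLik d τ).const_mul _).mul
      (.sum _ fun t => (M.bddMeas_V _ _).sub (.const _))
  rw [bayesRegret, expect]
  rw [integral_finsetSum _ fun d _ => (BddMeas.sum _ fun τ => hb d τ).integrable μ₀]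
  refine Finset.sum_congr rfl fun d _ => ?_
  rw [integral_finsetSum _ fun τ _ => (hb d τ).integrable μ₀]
  refine Finset.sum_congr rfl fun τ _ => ?_
  simp only [runProb_eq, mul_assoc, integral_const_mul]

/-! #### Algebra of the expectations -/

section Algebra

variable [IsProbabilityMeasure μ₀] {T : ℕ}
  {Φ Ψ : Θ → (Fin L → Traj S A H) → (Fin T → Traj S A H) → ℝ}
  {f g : Θ × Θ → (Fin L → Traj S A H) → (Fin T → Traj S A H) → ℝ}

theorem expect_add (hΦ : ∀ d τ, BddMeas fun θ => Φ θ d τ) (hΨ : ∀ d τ, BddMeas fun θ => Ψ θ d τ) :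
    M.expect opt μ₀ β (fun θ d τ => Φ θ d τ + Ψ θ d τ) =
      M.expect opt μ₀ β Φ + M.expect opt μ₀ β Ψ := by
  simp only [expect, ← Finset.sum_add_distrib, ← mul_add]
  refine Finset.sum_congr rfl fun d _ => Finset.sum_congr rfl fun τ _ => ?_
  rw [← integral_add (((bddMeas_dataLik d τ).mul (hΦ d τ)).integrable μ₀)
    (((bddMeas_dataLik d τ).mul (hΨ d τ)).integrable μ₀)]
  simp only [mul_add]

theorem expect_mono (hopt : ∀ θ, IsPolicy (opt θ)) (hΦ : ∀ d τ, BddMeas fun θ => Φ θ d τ)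
    (hΨ : ∀ d τ, BddMeas fun θ => Ψ θ d τ) (h : ∀ θ d τ, Φ θ d τ ≤ Ψ θ d τ) :
    M.expect opt μ₀ β Φ ≤ M.expect opt μ₀ β Ψ :=
  Finset.sum_le_sum fun d _ => Finset.sum_le_sum fun τ _ =>
    mul_le_mul_of_nonneg_left (integral_mono (((bddMeas_dataLik d τ).mul (hΦ d τ)).integrable μ₀)
      (((bddMeas_dataLik d τ).mul (hΨ d τ)).integrable μ₀)
      fun θ => mul_le_mul_of_nonneg_left (h θ d τ) (dataLik_nonneg d τ θ))
      (agentLik_nonneg hopt d τ)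

theorem expect_sum {ι : Type*} (s : Finset ι)
    {Φ : ι → Θ → (Fin L → Traj S A H) → (Fin T → Traj S A H) → ℝ}
    (hΦ : ∀ i d τ, BddMeas fun θ => Φ i θ d τ) :
    M.expect opt μ₀ β (fun θ d τ => ∑ i ∈ s, Φ i θ d τ) = ∑ i ∈ s, M.expect opt μ₀ β (Φ i) := by
  classical
  induction s using Finset.induction_on with
  | empty => simp [expect]
  | insert i s hi ih =>
    simp only [Finset.sum_insert hi, ← ih]
    exact expect_add (hΦ i) fun d τ => .sum _ fun j => hΦ j d τ

theorem bddMeas_dataLik_pair (d : Fin L → Traj S A H) (τ : Fin T → Traj S A H) :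
    BddMeas fun z : Θ × Θ => M.dataLik β d τ z.1 * M.dataLik β d τ z.2 :=
  ((bddMeas_dataLik d τ).comp measurable_fst).mul ((bddMeas_dataLik d τ).comp measurable_snd)

theorem expectPair_add (hf : ∀ d τ, BddMeas fun z => f z d τ)
    (hg : ∀ d τ, BddMeas fun z => g z d τ) :
    M.expectPair opt μ₀ β (fun z d τ => f z d τ + g z d τ) =
      M.expectPair opt μ₀ β f + M.expectPair opt μ₀ β g := by
  simp only [expectPair, ← Finset.sum_add_distrib, ← mul_add]
  refine Finset.sum_congr rfl fun d _ => Finset.sum_congr rfl fun τ _ => ?_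
  rw [← integral_add (((bddMeas_dataLik_pair d τ).mul (hf d τ)).integrable _)
    (((bddMeas_dataLik_pair d τ).mul (hg d τ)).integrable _)]
  simp only [mul_add]

theorem expectPair_mono (hopt : ∀ θ, IsPolicy (opt θ)) (hf : ∀ d τ, BddMeas fun z => f z d τ)
    (hg : ∀ d τ, BddMeas fun z => g z d τ) (h : ∀ z d τ, f z d τ ≤ g z d τ) :
    M.expectPair opt μ₀ β f ≤ M.expectPair opt μ₀ β g :=
  Finset.sum_le_sum fun d _ => Finset.sum_le_sum fun τ _ =>
    mul_le_mul_of_nonneg_left (mul_le_mul_of_nonneg_left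
      (integral_mono (((bddMeas_dataLik_pair d τ).mul (hf d τ)).integrable _)
        (((bddMeas_dataLik_pair d τ).mul (hg d τ)).integrable _)
        fun z => mul_le_mul_of_nonneg_left (h z d τ)
          (mul_nonneg (dataLik_nonneg d τ z.1) (dataLik_nonneg d τ z.2)))
      (inv_nonneg.2 (evidence_nonneg d τ))) (agentLik_nonneg hopt d τ)

omit [Nonempty A] [IsProbabilityMeasure μ₀] in
theorem expectPair_const_mul (c : ℝ) :
    M.expectPair opt μ₀ β (fun z d τ => c * f z d τ) = c * M.expectPair opt μ₀ β f := by
  simp only [expectPair, Finset.mul_sum, mul_left_comm _ c, integral_const_mul]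

theorem expectPair_sub (hf : ∀ d τ, BddMeas fun z => f z d τ)
    (hg : ∀ d τ, BddMeas fun z => g z d τ) :
    M.expectPair opt μ₀ β (fun z d τ => f z d τ - g z d τ) =
      M.expectPair opt μ₀ β f - M.expectPair opt μ₀ β g := by
  have h1 := expectPair_add (M := M) (opt := opt) (μ₀ := μ₀) (β := β)
    (fun d τ => (hf d τ).sub (hg d τ)) hg
  simp only [sub_add_cancel] at h1
  linarith

omit [Nonempty A] in
/-- Given the data, the true parameter and the posterior sample are exchangeable. -/
theorem expectPair_swap :
    M.expectPair opt μ₀ β (fun z d τ => f z.swap d τ) = M.expectPair opt μ₀ β f := by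
  simp only [expectPair]
  refine Finset.sum_congr rfl fun d _ => Finset.sum_congr rfl fun τ _ => ?_
  congr 2
  refine Eq.trans ?_ (integral_prod_swap fun z : Θ × Θ =>
    M.dataLik β d τ z.1 * M.dataLik β d τ z.2 * f z d τ)
  refine integral_congr_ae (Filter.Eventually.of_forall fun z => ?_)
  simp only [Prod.fst_swap, Prod.snd_swap]
  ring

theorem expectPair_fst :
    M.expectPair opt μ₀ β (fun z d τ => Φ z.1 d τ) = M.expect opt μ₀ β Φ := by
  simp only [expectPair, expect]
  refine Finset.sum_congr rfl fun d _ => Finset.sum_congr rfl fun τ _ => ?_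
  congr 1
  have h1 : ∀ z : Θ × Θ, M.dataLik β d τ z.1 * M.dataLik β d τ z.2 * Φ z.1 d τ =
      M.dataLik β d τ z.1 * Φ z.1 d τ * M.dataLik β d τ z.2 := fun z => by ring
  simp only [h1]
  rw [integral_prod_mul (fun θ => M.dataLik β d τ θ * Φ θ d τ) (fun θ => M.dataLik β d τ θ)]
  change (M.evidence μ₀ β d τ)⁻¹ * (_ * M.evidence μ₀ β d τ) = _
  -- The inverse of zero evidence is `0` by convention. This is harmless, since the likelihood then
  -- vanishes almost everywhere under the prior.
  by_cases h0 : M.evidence μ₀ β d τ = 0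
  · have h2 := (integral_eq_zero_iff_of_nonneg (dataLik_nonneg d τ)
      ((bddMeas_dataLik (M := M) (β := β) d τ).integrable μ₀)).1 h0
    rw [h0, mul_zero, mul_zero, eq_comm]
    refine integral_eq_zero_of_ae ?_
    filter_upwards [h2] with θ hθ
    rw [hθ, Pi.zero_apply, zero_mul]
  · field_simp

theorem expectPair_snd :
    M.expectPair opt μ₀ β (fun z d τ => Φ z.2 d τ) = M.expect opt μ₀ β Φ := by
  rw [← expectPair_fst]
  exact expectPair_swap (f := fun z d τ => Φ z.1 d τ)

/-- One more online episode: a posterior sample is drawn and its optimal policy is run. -/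
theorem expect_succ (hopt : M.IsPlanner opt)
    {Φ : Θ → (Fin L → Traj S A H) → (Fin (T + 1) → Traj S A H) → ℝ}
    (hΦ : ∀ d τ, BddMeas fun θ => Φ θ d τ) :
    M.expect opt μ₀ β Φ = M.expectPair opt μ₀ β fun z d (τ : Fin T → Traj S A H) =>
      ∑ x, M.trajProb z.1 (opt z.2) x * Φ z.1 d (Fin.snoc τ x) := by
  simp only [expect, expectPair]
  refine Finset.sum_congr rfl fun d _ => ?_
  rw [← Fintype.sum_equiv (Fin.snocEquiv fun _ : Fin (T + 1) => Traj S A H)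
    (fun y => M.agentLik opt μ₀ β d (Fin.snoc y.2 y.1 : Fin (T + 1) → Traj S A H) *
      ∫ θ, M.dataLik β d (Fin.snoc y.2 y.1 : Fin (T + 1) → Traj S A H) θ *
        Φ θ d (Fin.snoc y.2 y.1) ∂μ₀) _ (fun y => rfl), Fintype.sum_prod_type, Finset.sum_comm]
  refine Finset.sum_congr rfl fun τ _ => ?_
  simp only [agentLik_snoc, mul_assoc, ← Finset.mul_sum]
  congr 1
  simp only [actProb, mul_assoc, ← Finset.mul_sum]
  congr 1
  -- Transitions come from the truth and actions from the sample, so for each episode `x` the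
  -- integral over the pair is a product of two integrals.
  have h2 : ∀ z : Θ × Θ, M.dataLik β d τ z.1 * (M.dataLik β d τ z.2 *
      ∑ x, M.trajProb z.1 (opt z.2) x * Φ z.1 d (Fin.snoc τ x)) =
      ∑ x, (M.dataLik β d τ z.1 * M.transLik z.1 x * Φ z.1 d (Fin.snoc τ x)) *
        (M.dataLik β d τ z.2 * actLik (opt z.2) x) := by
    intro z
    simp only [Finset.mul_sum, trajProb_eq_mul]
    exact Finset.sum_congr rfl fun x _ => by ring
  simp only [h2]
  have hA := fun x => ((bddMeas_dataLik (M := M) (β := β) d τ).mul (M.bddMeas_transLik x)).mul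
    (hΦ d (Fin.snoc τ x))
  have hB := fun x => (bddMeas_dataLik (M := M) (β := β) d τ).mul
    (bddMeas_actLik (fun θ => (hopt.optimal θ).1) hopt.measurable x)
  rw [integral_finsetSum _ fun x _ => (((hA x).comp measurable_fst).mul
    ((hB x).comp measurable_snd)).integrable (μ₀.prod μ₀)]
  refine Finset.sum_congr rfl fun x _ => ?_
  rw [integral_prod_mul (fun θ => M.dataLik β d τ θ * M.transLik θ x * Φ θ d (Fin.snoc τ x))
    (fun θ => M.dataLik β d τ θ * actLik (opt θ) x), mul_comm]
  simp only [dataLik_snoc]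

omit [Nonempty A] in
theorem bddMeas_trajProb_pair (hopt : M.IsPlanner opt) (x : Traj S A H) :
    BddMeas fun z : Θ × Θ => M.trajProb z.1 (opt z.2) x := by
  simp only [trajProb_eq_mul]
  exact ((M.bddMeas_transLik x).comp measurable_fst).mul
    ((bddMeas_actLik (fun θ => (hopt.optimal θ).1) hopt.measurable x).comp measurable_snd)

/-- Forgetting the last episode. -/
theorem expect_init (hopt : M.IsPlanner opt) (hΦ : ∀ d τ, BddMeas fun θ => Φ θ d τ) :
    M.expect opt μ₀ β (fun θ d (τ : Fin (T + 1) → Traj S A H) => Φ θ d (Fin.init τ)) =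
      M.expect opt μ₀ β Φ := by
  rw [expect_succ hopt fun d τ => hΦ d _]
  simp only [Fin.init_snoc, ← Finset.sum_mul, sum_trajProb (hopt.optimal _).1, one_mul]
  exact expectPair_fst

/-- Functions of the parameter and the offline data alone. -/
theorem expect_offline (hopt : M.IsPlanner opt) (T : ℕ) {φ : Θ → (Fin L → Traj S A H) → ℝ}
    (hφ : ∀ d, BddMeas fun θ => φ θ d) :
    M.expect opt μ₀ β (fun θ d (_ : Fin T → Traj S A H) => φ θ d) =
      ∫ θ, ∑ d, M.offlineProb β θ d * φ θ d ∂μ₀ := by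
  induction T with
  | zero =>
    rw [integral_finsetSum _ fun d _ =>
      ((M.bddMeas_offlineProb β d).mul (hφ d)).integrable μ₀]
    simp [expect, agentLik, dataLik]
  | succ T ih =>
    rw [← ih]
    exact expect_init (Φ := fun θ d (_ : Fin T → Traj S A H) => φ θ d) hopt fun d _ => hφ d

theorem sum_offlineProb (θ : Θ) : ∑ d : Fin L → Traj S A H, M.offlineProb β θ d = 1 := by
  have h := sum_offlineProb_mul_exp (M := M) (θ := θ) (β := β) (L := L) fun _ => 0
  simpa [sum_trajProb (M.isPolicy_expert β θ)] using h

theorem expect_const (hopt : M.IsPlanner opt) (c : ℝ) :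
    M.expect opt μ₀ β (fun _ (_ : Fin L → Traj S A H) (_ : Fin T → Traj S A H) => c) = c := by
  rw [expect_offline hopt T (φ := fun _ _ => c) fun _ => .const c]
  simp [← Finset.sum_mul, sum_offlineProb]

/-- The Bayesian regret is the sum over the episodes of the expected regret of the posterior
sample. -/
theorem bayesRegret_eq_sum (hopt : M.IsPlanner opt) (T : ℕ) :
    M.bayesRegret opt μ₀ β L T = ∑ t ∈ Finset.range T, M.expectPair opt μ₀ β
      fun z (_ : Fin L → Traj S A H) (_ : Fin t → Traj S A H) => M.regret z.1 (opt z.2) := by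
  have hb : ∀ x : Traj S A H, BddMeas fun θ => M.V θ 0 (x.1 0) - M.totalReward x :=
    fun x => (M.bddMeas_V _ _).sub (.const _)
  induction T with
  | zero => simp [bayesRegret_eq_expect, expect]
  | succ T ih =>
    rw [Finset.sum_range_succ, ← ih, bayesRegret_eq_expect, bayesRegret_eq_expect]
    simp only [Fin.sum_univ_castSucc]
    rw [expect_add (fun d τ => .sum _ fun t => hb _) fun d τ => hb _]
    congr 1
    · exact expect_init (Φ := fun θ _ (τ : Fin T → Traj S A H) =>
        ∑ t, (M.V θ 0 ((τ t).1 0) - M.totalReward (τ t))) hopt fun d τ => .sum _ fun t => hb _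
    · rw [expect_succ hopt fun d τ => hb _]
      simp only [Fin.snoc_last, regret]

end Algebra

end Expect

/-! ### Probability of mismatch and exponential decay of the regret -/

section Mismatch

variable {S A Θ : Type*} [Fintype S] [Fintype A] [MeasurableSpace Θ] {H : ℕ}
  {M : MDPFamily S A Θ H} {opt : Θ → Policy S A H} {μ₀ : Measure Θ} {β Δ p : ℝ} {L T : ℕ}

open Classical in
/-- Indicator of the event that the optimal policies of two parameters reach different triples. -/
def mismatch (M : MDPFamily S A Θ H) (opt : Θ → Policy S A H) (z : Θ × Θ) : ℝ :=
  if M.reached z.1 (opt z.1) = M.reached z.2 (opt z.2) then 0 else 1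

theorem mismatch_mem (z : Θ × Θ) : M.mismatch opt z = 0 ∨ M.mismatch opt z = 1 := by
  unfold mismatch
  split_ifs <;> simp

theorem mismatch_nonneg (z : Θ × Θ) : 0 ≤ M.mismatch opt z := by
  rcases mismatch_mem (M := M) (opt := opt) z with h | h <;> simp [h]

theorem mismatch_le_one (z : Θ × Θ) : M.mismatch opt z ≤ 1 := by
  rcases mismatch_mem (M := M) (opt := opt) z with h | h <;> simp [h]

open Classical in
theorem bddMeas_ite {X : Type*} [MeasurableSpace X] {q : X → Prop} (hq : Measurable q) :
    BddMeas fun x => if q x then (0 : ℝ) else 1 :=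
  .of_mem_Icc (a := 0) (b := 1)
    (Measurable.ite (measurableSet_setOfPred.2 hq) measurable_const measurable_const)
    fun x => by split_ifs <;> simp

theorem measurable_stateProb (hopt : M.IsPlanner opt) (h : Fin H) (s : S) :
    Measurable fun θ => M.stateProb θ (opt θ) h s := by
  classical
  simp only [stateProb]
  refine Finset.measurable_sum _ fun x _ => ?_
  split_ifs
  · exact (bddMeas_trajProb_pair hopt x).measurable.comp (measurable_id.prodMk measurable_id)
  · exact measurable_const

theorem measurable_mem_reached (hopt : M.IsPlanner opt) (w : Fin H × S × A) :
    Measurable fun θ => w ∈ M.reached θ (opt θ) := by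
  have h : Measurable fun θ => M.stateProb θ (opt θ) w.1 w.2.1 * opt θ w.1 w.2.1 w.2.2 :=
    (measurable_stateProb hopt _ _).mul (hopt.measurable _ _ _)
  exact measurableSet_setOfPred.1 (measurableSet_lt measurable_const h)

/-- There are finitely many triples, so equality of the reached sets is a finite conjunction of
measurable conditions. -/
theorem bddMeas_mismatch (hopt : M.IsPlanner opt) : BddMeas (M.mismatch opt) := by
  refine bddMeas_ite ?_
  simp only [Set.ext_iff]
  exact Measurable.forall fun w => ((measurable_mem_reached hopt w).comp measurable_fst).iff
    ((measurable_mem_reached hopt w).comp measurable_snd)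

open Classical in
theorem bddMeas_reached_eq (hopt : M.IsPlanner opt) (F : Set (Fin H × S × A)) :
    BddMeas fun θ => if M.reached θ (opt θ) = F then (0 : ℝ) else 1 := by
  refine bddMeas_ite ?_
  simp only [Set.ext_iff]
  exact Measurable.forall fun w => (measurable_mem_reached hopt w).iff measurable_const

theorem bddMeas_regret [Nonempty A] (hopt : M.IsPlanner opt) :
    BddMeas fun z : Θ × Θ => M.regret z.1 (opt z.2) :=
  .sum _ fun x => (bddMeas_trajProb_pair hopt x).mul
    (((M.bddMeas_V _ _).comp measurable_fst).sub (.const _))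

theorem abs_regret_le_mismatch [Nonempty A] (hopt : M.IsPlanner opt) (hgap : M.HasGap Δ)
    (hΔ : 0 < Δ) (z : Θ × Θ) : |M.regret z.1 (opt z.2)| ≤ (H + 1) * M.mismatch opt z := by
  unfold mismatch
  split_ifs with h
  · rw [IsOptimal.regret_eq_zero_of_reached_eq hopt.optimal hgap hΔ h, abs_zero, mul_zero]
  · rw [mul_one]
    exact abs_regret_le (hopt.optimal z.2).1

theorem epsL_pos [Nonempty S] (hH : 1 ≤ H) : 0 < epsL (Fintype.card S) H p L := by
  have : 0 < Fintype.card S := Fintype.card_pos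
  rw [epsL, lt_min_iff]
  refine ⟨one_pos, ?_⟩
  positivity

/-- If the reached sets of truth and sample differ, at least one differs from the frequent set of
the offline data. Both have the same probability of doing so, because they have the same law given
the data. -/
theorem expectPair_mismatch_le [Nonempty A] [Nonempty S] [IsProbabilityMeasure μ₀]
    (hopt : M.IsPlanner opt) (hgap : M.HasGap Δ) (hΔ : 0 < Δ) (hβ : 0 ≤ β)
    (hp : ∀ θ h s, 0 < M.stateProb θ (opt θ) h s → p ≤ M.stateProb θ (opt θ) h s)
    (hp0 : 0 < p) (hp1 : p ≤ 1) (hH : 1 ≤ H)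
    (hβp : 2 * H * Fintype.card A * Real.exp (-(β * Δ)) ≤ p / 10) :
    M.expectPair opt μ₀ β (fun z (_ : Fin L → Traj S A H) (_ : Fin T → Traj S A H) =>
      M.mismatch opt z) ≤ epsL (Fintype.card S) H p L := by
  classical
  have hpol : ∀ θ, IsPolicy (opt θ) := fun θ => (hopt.optimal θ).1
  have hm := bddMeas_mismatch hopt
  rw [epsL, le_min_iff]
  constructor
  · rw [← expect_const (M := M) (μ₀ := μ₀) (β := β) (L := L) (T := T) hopt 1, ← expectPair_fst]
    exact expectPair_mono hpol (fun _ _ => hm) (fun _ _ => .const 1)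
      fun z _ _ => mismatch_le_one z
  · set φ : Θ → (Fin L → Traj S A H) → ℝ :=
      fun θ d => if M.reached θ (opt θ) = frequent p d then 0 else 1 with hφ
    have hφb : ∀ d, BddMeas fun θ => φ θ d := fun d => bddMeas_reached_eq hopt _
    have hle : M.expect opt μ₀ β (fun θ d (_ : Fin T → Traj S A H) => φ θ d) ≤
        (H * Fintype.card S + 1) * Real.exp (-(L * p / 18)) := by
      rw [expect_offline hopt T hφb]
      refine (integral_mono ((BddMeas.sum _ fun d =>
        (M.bddMeas_offlineProb β d).mul (hφb d)).integrable μ₀) (integrable_const _) fun θ =>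
        (hopt.optimal θ).sum_offlineProb_frequent_ne_le hgap hΔ hβ (hp θ) hp0 hβp L).trans ?_
      simp
    have h2 : M.expectPair opt μ₀ β (fun z (_ : Fin L → Traj S A H)
        (_ : Fin T → Traj S A H) => M.mismatch opt z) ≤
        2 * ((H * Fintype.card S + 1) * Real.exp (-(L * p / 18))) := by
      refine (expectPair_mono (g := fun z d (_ : Fin T → Traj S A H) => φ z.1 d + φ z.2 d) hpol
        (fun _ _ => hm) (fun d _ => ((hφb d).comp measurable_fst).add
          ((hφb d).comp measurable_snd)) fun z d _ => ?_).trans ?_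
      · simp only [mismatch, hφ]
        by_cases h1 : M.reached z.1 (opt z.1) = frequent p d <;>
          by_cases h2 : M.reached z.2 (opt z.2) = frequent p d
        · simp [h1, h2]
        all_goals
          simp only [h1, h2, if_true, if_false]
          try split_ifs
          all_goals norm_num
      · rw [expectPair_add (f := fun z d (_ : Fin T → Traj S A H) => φ z.1 d)
          (g := fun z d (_ : Fin T → Traj S A H) => φ z.2 d)
          (fun d _ => (hφb d).comp measurable_fst) (fun d _ => (hφb d).comp measurable_snd),
          expectPair_fst (Φ := fun θ d (_ : Fin T → Traj S A H) => φ θ d),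
          expectPair_snd (Φ := fun θ d (_ : Fin T → Traj S A H) => φ θ d)]
        linarith
    refine h2.trans ?_
    have hS : (1 : ℝ) ≤ Fintype.card S := by exact_mod_cast Fintype.card_pos
    have hH' : (1 : ℝ) ≤ H := by exact_mod_cast hH
    have hL : (0 : ℝ) ≤ L := L.cast_nonneg
    -- The Chernoff bound is stronger than `epsL`: since `p ≤ 1`, its exponential is at most each of
    -- the two in `epsL`, and `H S + 1 ≤ 2 H S`.
    have e1 : Real.exp (-(L * p / 18)) ≤ Real.exp (-(L * p ^ 2 / 18)) := by
      refine Real.exp_le_exp.2 ?_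
      have : L * p ^ 2 ≤ L * p := mul_le_mul_of_nonneg_left (by nlinarith) hL
      linarith
    have e2 : Real.exp (-(L * p / 18)) ≤ Real.exp (-(L * p / 36)) := by
      refine Real.exp_le_exp.2 ?_
      have : 0 ≤ L * p := mul_nonneg hL hp0.le
      linarith
    have h3 : (1 : ℝ) ≤ H * Fintype.card S := by nlinarith
    have h4 := (Real.exp_pos (-(L * p / 18))).le
    calc 2 * ((H * Fintype.card S + 1) * Real.exp (-(L * p / 18)))
        ≤ 2 * ((H * Fintype.card S + H * Fintype.card S) * Real.exp (-(L * p / 18))) := by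
          gcongr
      _ = 2 * Fintype.card S * H * (Real.exp (-(L * p / 18)) + Real.exp (-(L * p / 18))) := by
          ring
      _ ≤ _ := by gcongr

theorem abs_expectPair_le [Nonempty A] [IsProbabilityMeasure μ₀] (hopt : ∀ θ, IsPolicy (opt θ))
    {f g : Θ × Θ → (Fin L → Traj S A H) → (Fin T → Traj S A H) → ℝ}
    (hf : ∀ d τ, BddMeas fun z => f z d τ)
    (hg : ∀ d τ, BddMeas fun z => g z d τ) (h : ∀ z d τ, |f z d τ| ≤ g z d τ) :
    |M.expectPair opt μ₀ β f| ≤ M.expectPair opt μ₀ β g := by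
  refine abs_le'.2 ⟨expectPair_mono hopt hf hg fun z d τ => (le_abs_self _).trans (h z d τ), ?_⟩
  rw [← neg_one_mul, ← expectPair_const_mul]
  exact expectPair_mono hopt (fun d τ => (hf d τ).const_mul _) hg fun z d τ => by
    rw [neg_one_mul]
    exact (neg_le_abs _).trans (h z d τ)

theorem abs_bayesRegret_le [Nonempty A] [IsProbabilityMeasure μ₀]
    (hopt : M.IsPlanner opt) (hgap : M.HasGap Δ) (hΔ : 0 < Δ) {ε : ℝ}
    (hε : ∀ t, M.expectPair opt μ₀ β (fun z (_ : Fin L → Traj S A H)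
      (_ : Fin t → Traj S A H) => M.mismatch opt z) ≤ ε) :
    |M.bayesRegret opt μ₀ β L T| ≤ T * ((H + 1) * ε) := by
  rw [bayesRegret_eq_sum hopt]
  refine (Finset.abs_sum_le_sum_abs _ _).trans
    ((Finset.sum_le_card_nsmul _ _ ((H + 1) * ε) fun t _ => ?_).trans (by simp))
  refine (abs_expectPair_le (fun θ => (hopt.optimal θ).1) (fun _ _ => bddMeas_regret hopt)
    (fun _ _ => (bddMeas_mismatch hopt).const_mul (H + 1))
    fun z _ _ => abs_regret_le_mismatch hopt hgap hΔ z).trans ?_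
  rw [expectPair_const_mul]
  exact mul_le_mul_of_nonneg_left (hε t) (by positivity)

theorem epsL_le_exp (hp0 : 0 < p) (hp1 : p ≤ 1) (hH : 1 ≤ H) (n : ℕ) :
    epsL n H p L ≤ 4 * n * H * Real.exp (-(p ^ 2 / (36 * H) * (L * H))) := by
  have hL : (0 : ℝ) ≤ L := L.cast_nonneg
  have hH' : (0 : ℝ) < H := by exact_mod_cast hH
  have e0 : p ^ 2 / (36 * H) * (L * H) = L * p ^ 2 / 36 := by field_simp
  have h1 : L * p ^ 2 ≤ L * p := mul_le_mul_of_nonneg_left (by nlinarith) hL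
  have h2 : 0 ≤ L * p ^ 2 := by positivity
  have e1 : Real.exp (-(L * p ^ 2 / 18)) ≤ Real.exp (-(L * p ^ 2 / 36)) :=
    Real.exp_le_exp.2 (by linarith)
  have e2 : Real.exp (-(L * p / 36)) ≤ Real.exp (-(L * p ^ 2 / 36)) :=
    Real.exp_le_exp.2 (by linarith)
  rw [e0]
  refine (min_le_right _ _).trans ?_
  calc _ ≤ 2 * n * H * (Real.exp (-(L * p ^ 2 / 36)) + Real.exp (-(L * p ^ 2 / 36))) := by
        gcongr
    _ = _ := by ring

end Mismatch

end MDPFamily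

/-! ### A likelihood-ratio bound for empirical distributions -/

section Empirical

variable {ι : Type*} [Fintype ι]

/-- Pinsker-type inequality for the relative entropy to the midpoint. -/
theorem sq_sum_abs_sub_le {q P : ι → ℝ} (hq : q ∈ stdSimplex ℝ ι) (hP : P ∈ stdSimplex ℝ ι) :
    (∑ i, |q i - P i|) ^ 2 ≤ 16 * ∑ i, q i * Real.log (2 * q i / (P i + q i)) := by
  set m : ι → ℝ := fun i => (P i + q i) / 2 with hm
  have hm0 : ∀ i, 0 ≤ m i := fun i => div_nonneg (add_nonneg (hP.1 i) (hq.1 i)) (by norm_num)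
  have hm1 : ∑ i, m i = 1 := by
    simp only [hm, ← Finset.sum_div, Finset.sum_add_distrib, hP.2, hq.2]
    norm_num
  -- Relative entropy dominates squared Hellinger distance, by `log x ≤ x - 1` at `x = √m / √q`. The
  -- Cauchy-Schwarz inequality then passes to `ℓ¹`: one factor 4 comes from `q - P = 2 (q - m)`, the
  -- other from `h5`.
  have h1 : ∀ i, 2 * q i - 2 * (√(q i) * √(m i)) ≤ q i * Real.log (2 * q i / (P i + q i)) := by
    intro i
    rcases (hq.1 i).eq_or_lt with h0 | h0
    · simp [← h0]
    have hmi : 0 < m i := div_pos (add_pos_of_nonneg_of_pos (hP.1 i) h0) (by norm_num)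
    have e1 : 2 * q i / (P i + q i) = q i / m i := by
      have : P i + q i ≠ 0 := (add_pos_of_nonneg_of_pos (hP.1 i) h0).ne'
      simp only [hm]
      field_simp
    have e2 : Real.log (q i / m i) = -(2 * Real.log (√(m i) / √(q i))) := by
      rw [Real.log_div h0.ne' hmi.ne', Real.log_div (Real.sqrt_pos.2 hmi).ne'
        (Real.sqrt_pos.2 h0).ne', Real.log_sqrt hmi.le, Real.log_sqrt h0.le]
      ring
    have e3 := Real.log_le_sub_one_of_pos (div_pos (Real.sqrt_pos.2 hmi) (Real.sqrt_pos.2 h0))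
    have e4 : q i * (√(m i) / √(q i)) = √(q i) * √(m i) := by
      have : √(q i) ≠ 0 := (Real.sqrt_pos.2 h0).ne'
      nth_rewrite 1 [← Real.mul_self_sqrt h0.le]
      field_simp
    rw [e1, e2]
    nlinarith
  have h2 : ∑ i, (√(q i) - √(m i)) ^ 2 ≤ ∑ i, q i * Real.log (2 * q i / (P i + q i)) := by
    refine le_trans (le_of_eq ?_) (Finset.sum_le_sum fun i _ => h1 i)
    have e : ∀ i, (√(q i) - √(m i)) ^ 2 = q i + m i - 2 * (√(q i) * √(m i)) := by
      intro i
      rw [sub_sq, Real.sq_sqrt (hq.1 i), Real.sq_sqrt (hm0 i)]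
      ring
    simp only [e, Finset.sum_sub_distrib, Finset.sum_add_distrib, hm1, ← Finset.mul_sum, hq.2]
    ring
  have h3 : ∑ i, |q i - P i| = 2 * ∑ i, |√(q i) - √(m i)| * (√(q i) + √(m i)) := by
    rw [Finset.mul_sum]
    refine Finset.sum_congr rfl fun i _ => ?_
    have e : q i - P i = 2 * ((√(q i) - √(m i)) * (√(q i) + √(m i))) := by
      have a1 := Real.mul_self_sqrt (hq.1 i)
      have a2 := Real.mul_self_sqrt (hm0 i)
      have a3 : m i = (P i + q i) / 2 := rfl
      linear_combination (-2) * a1 + 2 * a2 - 2 * a3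
    rw [e, abs_mul, abs_mul, abs_of_nonneg (add_nonneg (Real.sqrt_nonneg _) (Real.sqrt_nonneg _))]
    norm_num
  have h4 := Finset.sum_mul_sq_le_sq_mul_sq Finset.univ (fun i => |√(q i) - √(m i)|)
    fun i => √(q i) + √(m i)
  have h5 : ∑ i, (√(q i) + √(m i)) ^ 2 ≤ 4 := by
    calc _ ≤ ∑ i, 2 * (q i + m i) := Finset.sum_le_sum fun i _ => by
          nlinarith [sq_nonneg (√(q i) - √(m i)), Real.sq_sqrt (hq.1 i), Real.sq_sqrt (hm0 i)]
      _ = 4 := by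
          rw [← Finset.mul_sum, Finset.sum_add_distrib, hq.2, hm1]
          norm_num
  have h6 : 0 ≤ ∑ i, (√(q i) - √(m i)) ^ 2 := Finset.sum_nonneg fun i _ => sq_nonneg _
  simp only [sq_abs] at h4
  rw [h3, mul_pow]
  nlinarith

/-- The frequencies of the counts `n` (zero if there are no observations). -/
def freq (n : ι → ℕ) (i : ι) : ℝ := n i / ∑ j, (n j : ℝ)

theorem freq_nonneg (n : ι → ℕ) (i : ι) : 0 ≤ freq n i := by unfold freq; positivity

theorem sum_freq_le_one (n : ι → ℕ) : ∑ i, freq n i ≤ 1 := by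
  simp only [freq, ← Finset.sum_div]
  exact div_self_le_one _

/-- The likelihood ratio of one observation, between `q` and the midpoint of `P` and `q`. -/
def midRatio (P q : ι → ℝ) (i : ι) : ℝ := 2 * q i / (P i + q i)

omit [Fintype ι] in
theorem midRatio_mem {P q : ι → ℝ} {i : ι} (hP : 0 ≤ P i) (hq : 0 ≤ q i) :
    midRatio P q i ∈ Set.Icc (0 : ℝ) 2 :=
  ⟨div_nonneg (by linarith) (by linarith),
    div_le_of_le_mul₀ (by linarith) (by norm_num) (by linarith)⟩

/-- The harmonic mean of `P` and `q` is at most their arithmetic mean. The midpoint keeps the ratio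
bounded by 2 even where `P` vanishes, and `∑ q ≤ 1` admits the zero frequencies of an empty sample.
-/
theorem sum_mul_midRatio_le {P q : ι → ℝ} (hP : P ∈ stdSimplex ℝ ι) (hq : ∀ i, 0 ≤ q i)
    (hq1 : ∑ i, q i ≤ 1) : ∑ i, P i * midRatio P q i ≤ 1 := by
  have h1 : ∀ i, P i * midRatio P q i ≤ (P i + q i) / 2 := by
    intro i
    rw [midRatio, ← mul_div_assoc]
    refine div_le_of_le_mul₀ (add_nonneg (hP.1 i) (hq i))
      (div_nonneg (add_nonneg (hP.1 i) (hq i)) (by norm_num)) ?_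
    nlinarith [sq_nonneg (P i - q i)]
  refine (Finset.sum_le_sum fun i _ => h1 i).trans ?_
  rw [← Finset.sum_div, Finset.sum_add_distrib, hP.2]
  linarith

/-- The likelihood ratio of the counts `n`, summed over the frequencies `q` that `T` observations
can have. -/
def mixRatio (P : ι → ℝ) (T : ℕ) (n : ι → ℕ) : ℝ :=
  open Classical in
  ∑ k : ι → Fin (T + 1), ∏ i, midRatio P (freq fun j => k j) i ^ n i

theorem mixRatio_nonneg {P : ι → ℝ} (hP : ∀ i, 0 ≤ P i) (T : ℕ) (n : ι → ℕ) :
    0 ≤ mixRatio P T n :=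
  Finset.sum_nonneg fun _ _ => Finset.prod_nonneg fun i _ =>
    pow_nonneg (midRatio_mem (hP i) (freq_nonneg _ i)).1 _

/-- The empirical frequencies depend on the data, whereas the supermartingale property needs a fixed
`q`. The sum over all possible count vectors dominates the ratio at the empirical one. -/
theorem prod_le_mixRatio {P : ι → ℝ} (hP : ∀ i, 0 ≤ P i) {T : ℕ} (n : ι → ℕ)
    (k : ι → Fin (T + 1)) :
    ∏ i, midRatio P (freq fun j => k j) i ^ n i ≤ mixRatio P T n := by
  classical
  unfold mixRatio
  refine Finset.single_le_sum (f := fun k : ι → Fin (T + 1) =>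
    ∏ i, midRatio P (freq fun j => k j) i ^ n i) (fun k _ => ?_) (Finset.mem_univ k)
  exact Finset.prod_nonneg fun i _ => pow_nonneg (midRatio_mem (hP i) (freq_nonneg _ i)).1 _

/-- The empirical distribution is within `16 (w + e⁻ʷ R + 1) / max 1 n` of `P` in squared total
variation, with `n` the number of observations and `R` the mixed likelihood ratio. -/
theorem sq_sum_abs_freq_sub_le {P : ι → ℝ} (hP : P ∈ stdSimplex ℝ ι) {T : ℕ} {n : ι → ℕ}
    (hn : ∀ i, n i ≤ T) {w : ℝ} (hw : 0 ≤ w) :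
    (∑ i, |freq n i - P i|) ^ 2 ≤
      16 * (w + 1 + Real.exp (-w) * mixRatio P T n) / max 1 (∑ i, (n i : ℝ)) := by
  classical
  set N : ℝ := ∑ i, (n i : ℝ) with hN
  have hG := mixRatio_nonneg hP.1 T n
  have hE := (Real.exp_pos (-w)).le
  rcases Nat.eq_zero_or_pos (∑ i, n i) with h0 | h0
  · have hN0 : N = 0 := by rw [hN]; exact_mod_cast h0
    have h1 : ∀ i, freq n i = 0 := fun i => by rw [freq, ← hN, hN0, div_zero]
    simp only [h1, zero_sub, abs_neg, abs_of_nonneg (hP.1 _), hP.2, hN0]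
    rw [max_eq_left (by norm_num), div_one]
    nlinarith [mul_nonneg hE hG]
  · have hN1 : 1 ≤ N := by rw [hN]; exact_mod_cast h0
    have hN0 : 0 < N := by linarith
    have hf : freq n ∈ stdSimplex ℝ ι := by
      refine ⟨freq_nonneg n, ?_⟩
      simp only [freq, ← Finset.sum_div]
      exact div_self hN0.ne'
    set R := ∏ i, midRatio P (freq n) i ^ n i with hR
    have hpos : ∀ i, 0 < midRatio P (freq n) i ^ n i := by
      intro i
      rcases Nat.eq_zero_or_pos (n i) with h | h
      · simp [h]
      · have : 0 < freq n i := div_pos (by exact_mod_cast h) hN0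
        exact pow_pos (div_pos (by linarith) (by linarith [hP.1 i])) _
    have hR0 : 0 < R := Finset.prod_pos fun i _ => hpos i
    have hRG : R ≤ mixRatio P T n :=
      prod_le_mixRatio hP.1 n fun i => ⟨n i, Nat.lt_succ_of_le (hn i)⟩
    have h2 : N * ∑ i, freq n i * Real.log (2 * freq n i / (P i + freq n i)) = Real.log R := by
      rw [hR, Real.log_prod fun i _ => (hpos i).ne', Finset.mul_sum]
      refine Finset.sum_congr rfl fun i _ => ?_
      rw [Real.log_pow, ← mul_assoc, midRatio]
      congr 1
      rw [freq, ← hN]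
      field_simp
    -- Use `log y ≤ y - 1` at `y = exp (-w) R`. The logarithm becomes linear in the mixed ratio,
    -- whose expectation is known, and `w` can be tuned later.
    have h3 : Real.log R ≤ w + 1 + Real.exp (-w) * mixRatio P T n := by
      have e1 := Real.log_le_sub_one_of_pos (mul_pos (Real.exp_pos (-w)) hR0)
      rw [Real.log_mul (Real.exp_pos _).ne' hR0.ne', Real.log_exp] at e1
      have e2 := mul_le_mul_of_nonneg_left hRG hE
      linarith
    rw [max_eq_right hN1, le_div_iff₀ hN0]
    have h4 := sq_sum_abs_sub_le hf hP
    nlinarith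

end Empirical

/-! ### Visit counts along the online episodes -/

/-- `∑_{k < n} 1 / max 1 k`. -/
def invSum (n : ℕ) : ℝ := ∑ k ∈ Finset.range n, (max 1 (k : ℝ))⁻¹

theorem invSum_mono {m n : ℕ} (h : m ≤ n) : invSum m ≤ invSum n :=
  Finset.sum_le_sum_of_subset_of_nonneg (Finset.range_mono h) fun _ _ _ =>
    inv_nonneg.2 (le_max_of_le_left zero_le_one)

theorem invSum_le {n : ℕ} (hn : 1 ≤ n) : invSum n ≤ 2 + Real.log n := by
  obtain ⟨m, rfl⟩ := Nat.exists_eq_add_of_le' hn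
  have h1 : invSum (m + 1) = (harmonic m : ℝ) + 1 := by
    rw [invSum, Finset.sum_range_succ', harmonic]
    push_cast
    congr 1
    · refine Finset.sum_congr rfl fun k _ => ?_
      rw [max_eq_right (by linarith [(k.cast_nonneg : (0 : ℝ) ≤ k)])]
    · simp
  have h2 := harmonic_le_one_add_log m
  have h3 : Real.log m ≤ Real.log ((m + 1 : ℕ) : ℝ) := by
    rcases Nat.eq_zero_or_pos m with h | h
    · simp [h]
    · exact Real.log_le_log (by exact_mod_cast h) (by push_cast; linarith)
  linarith

namespace MDPFamily

section Counts

variable {S A Θ : Type*} [Fintype S] [Fintype A] [MeasurableSpace Θ] {H : ℕ}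

open Classical in
/-- Is the move to `s'` made at the triple `w` in the episode `x`? -/
def episodeMove (w : Fin H × S × A) (x : Traj S A H) (s' : S) : ℕ :=
  if (x.1 w.1.castSucc = w.2.1 ∧ x.2 w.1 = w.2.2) ∧ x.1 w.1.succ = s' then 1 else 0

/-- The number of moves to `s'` made at the triple `w` in the episodes `τ`. -/
def moveCount (w : Fin H × S × A) {T : ℕ} (τ : Fin T → Traj S A H) (s' : S) : ℕ :=
  ∑ j, episodeMove w (τ j) s'

/-- The number of visits to the triple `w` in the episodes `τ`. -/
def visitCount (w : Fin H × S × A) {T : ℕ} (τ : Fin T → Traj S A H) : ℕ :=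
  ∑ s', moveCount w τ s'

omit [Fintype S] [Fintype A] in
theorem moveCount_snoc (w : Fin H × S × A) {T : ℕ} (τ : Fin T → Traj S A H) (x : Traj S A H)
    (s' : S) : moveCount w (Fin.snoc τ x : Fin (T + 1) → Traj S A H) s' =
      moveCount w τ s' + episodeMove w x s' := by
  simp only [moveCount, Fin.sum_univ_castSucc, Fin.snoc_castSucc, Fin.snoc_last]

omit [Fintype S] [Fintype A] in
theorem moveCount_le (w : Fin H × S × A) {T : ℕ} (τ : Fin T → Traj S A H) (s' : S) :
    moveCount w τ s' ≤ T := by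
  refine (Finset.sum_le_card_nsmul _ _ 1 fun j _ => ?_).trans (by simp)
  unfold episodeMove
  split_ifs <;> simp

open Classical in
omit [Fintype A] in
theorem sum_episodeMove (w : Fin H × S × A) (x : Traj S A H) :
    ∑ s', episodeMove w x s' =
      if x.1 w.1.castSucc = w.2.1 ∧ x.2 w.1 = w.2.2 then 1 else 0 := by
  unfold episodeMove
  split_ifs with h <;> simp [h]

open Classical in
omit [Fintype A] in
theorem prod_pow_episodeMove (w : Fin H × S × A) (x : Traj S A H) (r : S → ℝ) :
    ∏ s', r s' ^ episodeMove w x s' =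
      if x.1 w.1.castSucc = w.2.1 ∧ x.2 w.1 = w.2.2 then r (x.1 w.1.succ) else 1 := by
  unfold episodeMove
  split_ifs with h <;> simp [h, Finset.prod_ite_eq, pow_ite]

open Classical in
omit [Fintype A] in
theorem visitCount_snoc (w : Fin H × S × A) {T : ℕ} (τ : Fin T → Traj S A H)
    (x : Traj S A H) : visitCount w (Fin.snoc τ x : Fin (T + 1) → Traj S A H) =
      visitCount w τ + if x.1 w.1.castSucc = w.2.1 ∧ x.2 w.1 = w.2.2 then 1 else 0 := by
  simp only [visitCount, moveCount_snoc, Finset.sum_add_distrib, sum_episodeMove]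

omit [Fintype A] in
theorem visitCount_le (w : Fin H × S × A) {T : ℕ} (τ : Fin T → Traj S A H) :
    visitCount w τ ≤ T := by
  classical
  unfold visitCount moveCount
  rw [Finset.sum_comm]
  refine (Finset.sum_le_card_nsmul _ _ 1 fun j _ => ?_).trans (by simp)
  rw [sum_episodeMove]
  split_ifs <;> simp

/-- The sum over the visits of the inverse numbers of earlier visits. -/
def visitPotential {T : ℕ} (τ : Fin T → Traj S A H) : ℝ :=
  ∑ w : Fin H × S × A, invSum (visitCount w τ)

theorem visitPotential_snoc {T : ℕ} (τ : Fin T → Traj S A H) (x : Traj S A H) :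
    visitPotential (Fin.snoc τ x : Fin (T + 1) → Traj S A H) = visitPotential τ +
      ∑ h, (max 1 (visitCount (h, x.1 h.castSucc, x.2 h) τ : ℝ))⁻¹ := by
  classical
  have h1 : ∀ w : Fin H × S × A,
      invSum (visitCount w (Fin.snoc τ x : Fin (T + 1) → Traj S A H)) =
      invSum (visitCount w τ) + if x.1 w.1.castSucc = w.2.1 ∧ x.2 w.1 = w.2.2 then
        (max 1 (visitCount w τ : ℝ))⁻¹ else 0 := by
    intro w
    rw [visitCount_snoc]
    split_ifs
    · rw [invSum, Finset.sum_range_succ, invSum]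
    · simp
  simp only [visitPotential, h1, Finset.sum_add_distrib]
  congr 1
  rw [Fintype.sum_prod_type]
  refine Finset.sum_congr rfl fun h _ => ?_
  rw [Finset.sum_eq_single (x.1 h.castSucc, x.2 h)]
  · simp
  · rintro ⟨s, a⟩ _ hne
    refine if_neg fun hc => hne ?_
    rw [Prod.mk.injEq]
    exact ⟨hc.1.symm, hc.2.symm⟩
  · simp

theorem visitPotential_le {T : ℕ} (hT : 1 ≤ T) (τ : Fin T → Traj S A H) :
    visitPotential τ ≤ H * Fintype.card S * Fintype.card A * (2 + Real.log T) := by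
  refine (Finset.sum_le_card_nsmul _ _ (2 + Real.log T) fun w _ =>
    (invSum_mono (visitCount_le w τ)).trans (invSum_le hT)).trans (le_of_eq ?_)
  simp only [Finset.card_univ, Fintype.card_prod, Fintype.card_fin, nsmul_eq_mul]
  push_cast
  ring

variable {M : MDPFamily S A Θ H} {opt : Θ → Policy S A H} {μ₀ : Measure Θ} {β : ℝ}
  [IsProbabilityMeasure μ₀] [Nonempty A] {L : ℕ}

/-- Each summand is the expected increase of `visitPotential` in one episode. The sum telescopes to
its final expectation, which has a deterministic bound. -/
theorem sum_expectPair_inv_visitCount_le (hopt : M.IsPlanner opt) {T : ℕ} (hT : 1 ≤ T) :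
    ∑ t ∈ Finset.range T, M.expectPair opt μ₀ β (fun z (_ : Fin L → Traj S A H)
      (τ : Fin t → Traj S A H) => ∑ x, M.trajProb z.1 (opt z.2) x *
        ∑ h, (max 1 (visitCount (h, x.1 h.castSucc, x.2 h) τ : ℝ))⁻¹) ≤
      H * Fintype.card S * Fintype.card A * (2 + Real.log T) := by
  have h1 : ∀ T : ℕ, ∑ t ∈ Finset.range T, M.expectPair opt μ₀ β (fun z
      (_ : Fin L → Traj S A H) (τ : Fin t → Traj S A H) => ∑ x, M.trajProb z.1 (opt z.2) x *
        ∑ h, (max 1 (visitCount (h, x.1 h.castSucc, x.2 h) τ : ℝ))⁻¹) =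
      M.expect opt μ₀ β fun _ (_ : Fin L → Traj S A H) (τ : Fin T → Traj S A H) =>
        visitPotential τ := by
    intro T
    induction T with
    | zero => simp [expect, visitPotential, visitCount, moveCount, invSum]
    | succ T ih =>
      rw [Finset.sum_range_succ, ih, expect_succ (T := T)
        (Φ := fun _ (_ : Fin L → Traj S A H) τ => visitPotential τ) hopt fun _ _ => .const _]
      simp only [visitPotential_snoc, mul_add, Finset.sum_add_distrib, ← Finset.sum_mul,
        sum_trajProb (hopt.optimal _).1, one_mul]
      rw [expectPair_add (f := fun _ (_ : Fin L → Traj S A H) τ => visitPotential τ)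
        (g := fun z (_ : Fin L → Traj S A H) (τ : Fin T → Traj S A H) =>
          ∑ x, M.trajProb z.1 (opt z.2) x *
            ∑ h, (max 1 (visitCount (h, x.1 h.castSucc, x.2 h) τ : ℝ))⁻¹)
        (fun _ _ => .const _) fun _ _ => .sum _ fun x => (bddMeas_trajProb_pair hopt x).mul (.const _)]
      congr 1
      exact (expectPair_fst (Φ := fun _ (_ : Fin L → Traj S A H) τ => visitPotential τ)).symm
  rw [h1, ← expect_const (M := M) (μ₀ := μ₀) (β := β) (L := L) (T := T) hopt
    (H * Fintype.card S * Fintype.card A * (2 + Real.log T))]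
  exact expect_mono (fun θ => (hopt.optimal θ).1) (fun _ _ => .const _) (fun _ _ => .const _)
    fun _ _ τ => visitPotential_le hT τ

omit [Fintype A] [Nonempty A] in
theorem bddMeas_midRatio (w : Fin H × S × A) {q : S → ℝ} (hq : ∀ s, 0 ≤ q s) (s' : S) :
    BddMeas fun θ => midRatio (M.P θ w.1 w.2.1 w.2.2) q s' :=
  .of_mem_Icc (measurable_const.div ((M.P_measurable _ _ _ _).add measurable_const))
    fun θ => midRatio_mem ((M.P_mem θ _ _ _).1 s') (hq s')

/-- The likelihood ratio against a fixed distribution is a supermartingale. -/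
theorem expect_prod_midRatio_le (hopt : M.IsPlanner opt) (w : Fin H × S × A) {q : S → ℝ}
    (hq : ∀ s, 0 ≤ q s) (hq1 : ∑ s, q s ≤ 1) (T : ℕ) :
    M.expect opt μ₀ β (fun θ (_ : Fin L → Traj S A H) (τ : Fin T → Traj S A H) =>
      ∏ s', midRatio (M.P θ w.1 w.2.1 w.2.2) q s' ^ moveCount w τ s') ≤ 1 := by
  classical
  have hpow : ∀ n : S → ℕ, BddMeas fun θ =>
      ∏ s', midRatio (M.P θ w.1 w.2.1 w.2.2) q s' ^ n s' := by
    intro n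
    refine .prod _ fun s' => ?_
    simp only [← Fin.prod_const]
    exact .prod _ fun _ => bddMeas_midRatio w hq s'
  induction T with
  | zero =>
    refine le_of_eq ((congrArg _ ?_).trans (expect_const hopt 1))
    funext θ d τ
    simp [moveCount]
  | succ T ih =>
    refine le_trans ?_ ih
    rw [expect_succ hopt fun _ _ => hpow _, ← expectPair_fst]
    refine expectPair_mono (fun θ => (hopt.optimal θ).1) (fun _ _ => .sum _ fun x =>
      (bddMeas_trajProb_pair hopt x).mul ((hpow _).comp measurable_fst))
      (fun _ _ => (hpow _).comp measurable_fst) fun z _ τ => ?_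
    have hπ := (hopt.optimal z.2).1
    have hP := M.P_mem z.1
    simp only [moveCount_snoc, pow_add, Finset.prod_mul_distrib, prod_pow_episodeMove,
      mul_left_comm (M.trajProb z.1 (opt z.2) _), ← Finset.mul_sum]
    refine mul_le_of_le_one_right (Finset.prod_nonneg fun s' _ =>
      pow_nonneg (midRatio_mem ((hP _ _ _).1 _) (hq _)).1 _) ?_
    -- A new episode multiplies the ratio by at most one factor, drawn at period `w.1`. Given the
    -- state and action there, its mean is at most 1 if the triple is `w`, and it equals 1
    -- otherwise.
    have h1 := sum_trajProb_mul_move (M := M) (θ := z.1) hπ w.1 fun s a s' =>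
      if s = w.2.1 ∧ a = w.2.2 then midRatio (M.P z.1 w.1 w.2.1 w.2.2) q s' else 1
    refine (le_of_eq h1).trans ?_
    refine (Finset.sum_le_sum fun x _ => mul_le_of_le_one_right (trajProb_nonneg hπ x) ?_).trans_eq
      (sum_trajProb (M := M) (θ := z.1) hπ)
    refine (Finset.sum_le_sum fun a _ => mul_le_of_le_one_right ((hπ _ _).1 a) ?_).trans_eq
      (hπ w.1 (x.1 w.1.castSucc)).2
    split_ifs with hc
    · rw [hc.1, hc.2]
      exact sum_mul_midRatio_le (hP _ _ _) hq hq1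
    · simp only [mul_one]
      exact (hP _ _ _).2.le

omit [Fintype A] [Nonempty A] in
theorem bddMeas_mixRatio (w : Fin H × S × A) (T : ℕ) (n : S → ℕ) :
    BddMeas fun θ => mixRatio (M.P θ w.1 w.2.1 w.2.2) T n := by
  classical
  refine .sum _ fun k => .prod _ fun s' => ?_
  simp only [← Fin.prod_const]
  exact .prod _ fun _ => bddMeas_midRatio w (freq_nonneg _) s'

theorem expect_mixRatio_le (hopt : M.IsPlanner opt) (w : Fin H × S × A) (T t : ℕ) :
    M.expect opt μ₀ β (fun θ (_ : Fin L → Traj S A H) (τ : Fin t → Traj S A H) =>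
      mixRatio (M.P θ w.1 w.2.1 w.2.2) T (moveCount w τ)) ≤
      ((T : ℝ) + 1) ^ Fintype.card S := by
  classical
  unfold mixRatio
  rw [expect_sum (Φ := fun (k : S → Fin (T + 1)) θ (_ : Fin L → Traj S A H)
    (τ : Fin t → Traj S A H) => ∏ s', midRatio (M.P θ w.1 w.2.1 w.2.2)
      (freq fun j => (k j : ℕ)) s' ^ moveCount w τ s')]
  · refine (Finset.sum_le_card_nsmul _ _ 1 fun k _ =>
      expect_prod_midRatio_le hopt w (freq_nonneg _) (sum_freq_le_one _) t).trans (le_of_eq ?_)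
    simp
  · intro k d τ
    refine .prod _ fun s' => ?_
    simp only [← Fin.prod_const]
    exact .prod _ fun _ => bddMeas_midRatio w (freq_nonneg _) s'

end Counts

/-! ### Squared transition errors and the square-root regret bound -/

section Regret

variable {S A Θ : Type*} [Fintype S] [Fintype A] [MeasurableSpace Θ] {H : ℕ}
  {M : MDPFamily S A Θ H} {opt : Θ → Policy S A H} {μ₀ : Measure Θ} {β Δ : ℝ} {L : ℕ}

/-- The `ℓ¹` distance between the transition probabilities of two parameters at the triple `w`. -/
def transDist (M : MDPFamily S A Θ H) (z : Θ × Θ) (w : Fin H × S × A) : ℝ :=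
  ∑ s', |M.P z.2 w.1 w.2.1 w.2.2 s' - M.P z.1 w.1 w.2.1 w.2.2 s'|

omit [Fintype A] in
theorem bddMeas_transDist (w : Fin H × S × A) : BddMeas fun z => M.transDist z w :=
  .sum _ fun _ => (((M.bddMeas_P _ _ _ _).comp measurable_snd).sub
    ((M.bddMeas_P _ _ _ _).comp measurable_fst)).abs

omit [Fintype A] in
theorem sq_transDist_le (z : Θ × Θ) (w : Fin H × S × A) {t T : ℕ} (htT : t ≤ T)
    (τ : Fin t → Traj S A H) {c : ℝ} (hc : 0 ≤ c) :
    M.transDist z w ^ 2 ≤ 64 * (c + 1) * (max 1 (visitCount w τ : ℝ))⁻¹ +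
      32 * Real.exp (-c) * (mixRatio (M.P z.1 w.1 w.2.1 w.2.2) T (moveCount w τ) +
        mixRatio (M.P z.2 w.1 w.2.1 w.2.2) T (moveCount w τ)) := by
  set m : ℝ := max 1 (visitCount w τ : ℝ) with hm
  have hm1 : 1 ≤ m := le_max_left _ _
  have key : ∀ θ, (∑ s', |freq (moveCount w τ) s' - M.P θ w.1 w.2.1 w.2.2 s'|) ^ 2 ≤
      16 * (c + 1) * m⁻¹ +
        16 * Real.exp (-c) * mixRatio (M.P θ w.1 w.2.1 w.2.2) T (moveCount w τ) := by
    intro θ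
    have hP := M.P_mem θ w.1 w.2.1 w.2.2
    have h1 := sq_sum_abs_freq_sub_le hP
      (fun s' => (moveCount_le w τ s').trans htT) hc
    have h2 : max 1 (∑ s', (moveCount w τ s' : ℝ)) = m := by
      rw [hm, visitCount]
      push_cast
      rfl
    rw [h2, div_eq_mul_inv] at h1
    have h3 : 0 ≤ Real.exp (-c) * mixRatio (M.P θ w.1 w.2.1 w.2.2) T (moveCount w τ) :=
      mul_nonneg (Real.exp_pos _).le (mixRatio_nonneg hP.1 _ _)
    -- The inverse count is needed only on the `c + 1` term. On the mixed ratio it may be dropped,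
    -- as `exp (-c)` will be tiny.
    have h4 := mul_le_of_le_one_right h3 (inv_le_one_of_one_le₀ hm1)
    nlinarith
  have h1 : M.transDist z w ≤
      ∑ s', |freq (moveCount w τ) s' - M.P z.1 w.1 w.2.1 w.2.2 s'| +
      ∑ s', |freq (moveCount w τ) s' - M.P z.2 w.1 w.2.1 w.2.2 s'| := by
    rw [transDist, ← Finset.sum_add_distrib]
    refine Finset.sum_le_sum fun s' _ => ?_
    rw [add_comm, abs_sub_comm (freq (moveCount w τ) s') (M.P z.2 w.1 w.2.1 w.2.2 s')]
    exact abs_sub_le _ _ _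
  have h2 : 0 ≤ M.transDist z w := Finset.sum_nonneg fun _ _ => abs_nonneg _
  have h3 := pow_le_pow_left₀ h2 h1 2
  refine h3.trans ((add_sq_le).trans ?_)
  have k1 := key z.1
  have k2 := key z.2
  linarith

variable [Nonempty A] [IsProbabilityMeasure μ₀]

/-- The mixed ratio at the random visited triple is dominated by the sum over all triples, which
removes its dependence on the policy. By exchangeability the sums for truth and sample have the same
expectation. -/
theorem expectPair_sq_transDist_le (hopt : M.IsPlanner opt) {t T : ℕ} (htT : t ≤ T) {c : ℝ}
    (hc : 0 ≤ c) :
    M.expectPair opt μ₀ β (fun z (_ : Fin L → Traj S A H) (_ : Fin t → Traj S A H) =>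
        ∑ x, M.trajProb z.1 (opt z.2) x *
          ∑ h, M.transDist z (h, x.1 h.castSucc, x.2 h) ^ 2) ≤
      64 * (c + 1) * M.expectPair opt μ₀ β (fun z (_ : Fin L → Traj S A H)
        (τ : Fin t → Traj S A H) => ∑ x, M.trajProb z.1 (opt z.2) x *
          ∑ h, (max 1 (visitCount (h, x.1 h.castSucc, x.2 h) τ : ℝ))⁻¹) +
      64 * Real.exp (-c) *
        (H * Fintype.card S * Fintype.card A * ((T : ℝ) + 1) ^ Fintype.card S) := by
  have hpol : ∀ θ, IsPolicy (opt θ) := fun θ => (hopt.optimal θ).1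
  set G : Θ → (Fin L → Traj S A H) → (Fin t → Traj S A H) → ℝ := fun θ _ τ =>
    ∑ w : Fin H × S × A, mixRatio (M.P θ w.1 w.2.1 w.2.2) T (moveCount w τ) with hG
  set I : Θ × Θ → (Fin L → Traj S A H) → (Fin t → Traj S A H) → ℝ := fun z _ τ =>
    ∑ x, M.trajProb z.1 (opt z.2) x *
      ∑ h, (max 1 (visitCount (h, x.1 h.castSucc, x.2 h) τ : ℝ))⁻¹ with hI
  have hGb : ∀ d τ, BddMeas fun θ => G θ d τ := fun d τ =>
    .sum _ fun w => bddMeas_mixRatio w T _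
  have hIb : ∀ d τ, BddMeas fun z => I z d τ := fun d τ =>
    .sum _ fun x => (bddMeas_trajProb_pair hopt x).mul (.const _)
  have hGle : M.expect opt μ₀ β G ≤
      H * Fintype.card S * Fintype.card A * ((T : ℝ) + 1) ^ Fintype.card S := by
    rw [hG, expect_sum (Φ := fun (w : Fin H × S × A) θ (_ : Fin L → Traj S A H)
      (τ : Fin t → Traj S A H) => mixRatio (M.P θ w.1 w.2.1 w.2.2) T (moveCount w τ))
      _ fun w _ _ => bddMeas_mixRatio w T _]
    refine (Finset.sum_le_card_nsmul _ _ _ fun w _ =>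
      expect_mixRatio_le hopt w T t).trans (le_of_eq ?_)
    simp only [Finset.card_univ, Fintype.card_prod, Fintype.card_fin, nsmul_eq_mul]
    push_cast
    ring
  have hpt : ∀ z (d : Fin L → Traj S A H) τ, ∑ x, M.trajProb z.1 (opt z.2) x *
      ∑ h, M.transDist z (h, x.1 h.castSucc, x.2 h) ^ 2 ≤
      64 * (c + 1) * I z d τ + 32 * Real.exp (-c) * (G z.1 d τ + G z.2 d τ) := by
    intro z d τ
    have h1 : ∀ x : Traj S A H, ∑ h, M.transDist z (h, x.1 h.castSucc, x.2 h) ^ 2 ≤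
        64 * (c + 1) * ∑ h, (max 1 (visitCount (h, x.1 h.castSucc, x.2 h) τ : ℝ))⁻¹ +
        32 * Real.exp (-c) * (G z.1 d τ + G z.2 d τ) := by
      intro x
      refine (Finset.sum_le_sum fun h _ => sq_transDist_le z _ htT τ hc).trans ?_
      rw [Finset.sum_add_distrib, ← Finset.mul_sum, ← Finset.mul_sum]
      refine add_le_add_right (mul_le_mul_of_nonneg_left ?_
        (mul_nonneg (by norm_num) (Real.exp_pos _).le)) _
      simp only [hG, ← Finset.sum_add_distrib]
      have h0 : ∀ w : Fin H × S × A,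
          0 ≤ mixRatio (M.P z.1 w.1 w.2.1 w.2.2) T (moveCount w τ) +
            mixRatio (M.P z.2 w.1 w.2.1 w.2.2) T (moveCount w τ) := fun w =>
        add_nonneg (mixRatio_nonneg (M.P_mem _ _ _ _).1 _ _)
          (mixRatio_nonneg (M.P_mem _ _ _ _).1 _ _)
      rw [Fintype.sum_prod_type]
      exact Finset.sum_le_sum fun h _ => Finset.single_le_sum
        (f := fun y : S × A => mixRatio (M.P z.1 h y.1 y.2) T (moveCount (h, y) τ) +
            mixRatio (M.P z.2 h y.1 y.2) T (moveCount (h, y) τ))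
        (fun y _ => h0 (h, y)) (Finset.mem_univ (x.1 h.castSucc, x.2 h))
    refine (Finset.sum_le_sum fun x _ =>
      mul_le_mul_of_nonneg_left (h1 x) (trajProb_nonneg (hpol z.2) x)).trans (le_of_eq ?_)
    simp only [mul_add (M.trajProb z.1 (opt z.2) _), Finset.sum_add_distrib, ← Finset.sum_mul,
      sum_trajProb (hpol z.2), one_mul, mul_left_comm (M.trajProb z.1 (opt z.2) _),
      ← Finset.mul_sum, hI]
  refine (expectPair_mono (g := fun z d τ => 64 * (c + 1) * I z d τ +
    32 * Real.exp (-c) * (G z.1 d τ + G z.2 d τ)) hpol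
    (fun _ _ => .sum _ fun x => (bddMeas_trajProb_pair hopt x).mul (.sum _ fun h => ?_))
    (fun d τ => ((hIb d τ).const_mul _).add ((((hGb d τ).comp measurable_fst).add
      ((hGb d τ).comp measurable_snd)).const_mul _)) hpt).trans ?_
  · simp only [pow_two]
    exact (bddMeas_transDist _).mul (bddMeas_transDist _)
  rw [expectPair_add (f := fun z d τ => 64 * (c + 1) * I z d τ)
    (g := fun z d τ => 32 * Real.exp (-c) * (G z.1 d τ + G z.2 d τ))
    (fun d τ => (hIb d τ).const_mul _) (fun d τ => (((hGb d τ).comp measurable_fst).add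
      ((hGb d τ).comp measurable_snd)).const_mul _),
    expectPair_const_mul, expectPair_const_mul (f := fun z d τ => G z.1 d τ + G z.2 d τ),
    expectPair_add (f := fun z d τ => G z.1 d τ) (g := fun z d τ => G z.2 d τ)
    (fun d τ => (hGb d τ).comp measurable_fst) (fun d τ => (hGb d τ).comp measurable_snd),
    expectPair_fst, expectPair_snd]
  have := mul_le_mul_of_nonneg_left hGle (Real.exp_pos (-c)).le
  linarith

/-- The total expected squared distance between the transition probabilities of the truth and of
the posterior samples, at the triples visited. -/
theorem sum_expectPair_sq_transDist_le [Nonempty S] (hopt : M.IsPlanner opt) {T : ℕ}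
    (hT : 1 ≤ T) :
    ∑ t ∈ Finset.range T, M.expectPair opt μ₀ β (fun z (_ : Fin L → Traj S A H)
        (_ : Fin t → Traj S A H) => ∑ x, M.trajProb z.1 (opt z.2) x *
          ∑ h, M.transDist z (h, x.1 h.castSucc, x.2 h) ^ 2) ≤
      320 * (H * (Fintype.card S : ℝ) ^ 2 * Fintype.card A * (1 + Real.log T) ^ 2) := by
  have hT1 : (1 : ℝ) ≤ T := by exact_mod_cast hT
  have hT0 : (0 : ℝ) < T := by linarith
  have hlog : 0 ≤ Real.log T := Real.log_nonneg hT1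
  have hS : (1 : ℝ) ≤ Fintype.card S := by exact_mod_cast Fintype.card_pos
  have hlog1 : 0 ≤ Real.log (T + 1) := Real.log_nonneg (by linarith)
  have hlog2 : Real.log (T + 1) ≤ 1 + Real.log T := by
    have h1 : Real.log (Real.exp 1 * T) = 1 + Real.log T := by
      rw [Real.log_mul (Real.exp_pos 1).ne' hT0.ne', Real.log_exp]
    rw [← h1]
    refine Real.log_le_log (by linarith) ?_
    nlinarith [Real.add_one_le_exp (1 : ℝ)]
  -- Chosen so that `exp (-c)` cancels both the number of count vectors and the `T` episodes; the `c
  -- + 1` in the main term then supplies one more factor `S (1 + log T)`.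
  set c : ℝ := Fintype.card S * Real.log (T + 1) + Real.log T with hc
  have hc0 : 0 ≤ c := by positivity
  have hexp : Real.exp (-c) * ((T : ℝ) + 1) ^ Fintype.card S * T = 1 := by
    have h1 : Real.exp c = ((T : ℝ) + 1) ^ Fintype.card S * T := by
      rw [hc, Real.exp_add, Real.exp_nat_mul, Real.exp_log (by linarith), Real.exp_log hT0]
    rw [mul_assoc, ← h1, ← Real.exp_add, neg_add_cancel, Real.exp_zero]
  refine (Finset.sum_le_sum fun t ht => expectPair_sq_transDist_le hopt
    (Finset.mem_range.1 ht).le hc0).trans ?_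
  rw [Finset.sum_add_distrib, ← Finset.mul_sum]
  refine (add_le_add_left (mul_le_mul_of_nonneg_left (sum_expectPair_inv_visitCount_le hopt hT)
    (by positivity)) _).trans ?_
  simp only [Finset.sum_const, Finset.card_range, nsmul_eq_mul]
  set l := Real.log T
  set X : ℝ := H * Fintype.card S * Fintype.card A with hX
  have hX0 : 0 ≤ X := by positivity
  have e1 : (T : ℝ) * (64 * Real.exp (-c) * (X * ((T : ℝ) + 1) ^ Fintype.card S)) = 64 * X := by
    linear_combination 64 * X * hexp
  rw [e1]
  have e2 : c + 1 ≤ 2 * (Fintype.card S * (1 + l)) := by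
    rw [hc]
    nlinarith
  have e3 : (c + 1) * (2 + l) ≤ 4 * (Fintype.card S * (1 + l) ^ 2) := by
    have := mul_le_mul e2 (show 2 + l ≤ 2 * (1 + l) by linarith) (by linarith) (by positivity)
    linarith
  have e4 : (1 : ℝ) ≤ Fintype.card S * (1 + l) ^ 2 := by nlinarith
  have e5 : (c + 1) * (2 + l) * X ≤ 4 * (Fintype.card S * (1 + l) ^ 2) * X :=
    mul_le_mul_of_nonneg_right e3 hX0
  have e6 : X ≤ Fintype.card S * (1 + l) ^ 2 * X := le_mul_of_one_le_left hX0 e4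
  calc 64 * (c + 1) * (X * (2 + l)) + 64 * X ≤ 320 * (Fintype.card S * (1 + l) ^ 2 * X) := by
        linarith
    _ = _ := by
        rw [hX]
        ring

/-- Posterior sampling replaces optimism by symmetry: on the mismatch event the unknown optimal
value is exchanged for that of the sample, leaving the simulation error of a single policy. The free
`k` balances mismatch probability against squared error. -/
theorem expectPair_regret_le (hopt : M.IsPlanner opt) (hgap : M.HasGap Δ) (hΔ : 0 < Δ) (t : ℕ)
    {k : ℝ} (hk : 0 < k) :
    M.expectPair opt μ₀ β (fun z (_ : Fin L → Traj S A H) (_ : Fin t → Traj S A H) =>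
        M.regret z.1 (opt z.2)) ≤
      (H + 1) * (H / (2 * k) * M.expectPair opt μ₀ β (fun z (_ : Fin L → Traj S A H)
          (_ : Fin t → Traj S A H) => M.mismatch opt z) +
        k / 2 * M.expectPair opt μ₀ β (fun z (_ : Fin L → Traj S A H)
          (_ : Fin t → Traj S A H) => ∑ x, M.trajProb z.1 (opt z.2) x *
            ∑ h, M.transDist z (h, x.1 h.castSucc, x.2 h) ^ 2)) := by
  have hpol : ∀ θ, IsPolicy (opt θ) := fun θ => (hopt.optimal θ).1
  have hm := bddMeas_mismatch hopt
  set D : Θ × Θ → ℝ := fun z => ∑ x, M.trajProb z.1 (opt z.2) x *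
    ∑ h, M.transDist z (h, x.1 h.castSucc, x.2 h) ^ 2 with hD
  have hDb : BddMeas D := .sum _ fun x => (bddMeas_trajProb_pair hopt x).mul (.sum _ fun h => by
    simp only [pow_two]
    exact (bddMeas_transDist _).mul (bddMeas_transDist _))
  set V₀ : Θ → ℝ := fun θ => ∑ s, M.ν s * M.V θ 0 s with hV
  have hVb : BddMeas V₀ := .sum _ fun s => (M.bddMeas_V 0 s).const_mul _
  have hvb : BddMeas fun z : Θ × Θ => M.value z.1 (opt z.2) :=
    .sum _ fun x => (bddMeas_trajProb_pair hopt x).mul (.const _)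
  have hval : ∀ θ, V₀ θ = M.value θ (opt θ) := fun θ => by
    have h1 := (hopt.optimal θ).regret_eq_zero hgap hΔ
    rw [regret_eq (hpol θ)] at h1
    exact sub_eq_zero.1 h1
  have hreg : ∀ z : Θ × Θ, M.regret z.1 (opt z.2) =
      M.mismatch opt z * V₀ z.1 - M.mismatch opt z * M.value z.1 (opt z.2) := by
    intro z
    rw [← mul_sub, hV, ← regret_eq (hpol z.2)]
    unfold mismatch
    split_ifs with h
    · rw [IsOptimal.regret_eq_zero_of_reached_eq hopt.optimal hgap hΔ h, mul_zero]
    · rw [one_mul]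
  have hswap : M.expectPair opt μ₀ β (fun z (_ : Fin L → Traj S A H)
      (_ : Fin t → Traj S A H) => M.mismatch opt z * V₀ z.1) =
      M.expectPair opt μ₀ β (fun z (_ : Fin L → Traj S A H)
      (_ : Fin t → Traj S A H) => M.mismatch opt z * V₀ z.2) := by
    rw [← expectPair_swap]
    simp only [mismatch, Prod.fst_swap, Prod.snd_swap, eq_comm]
  simp only [hreg]
  rw [expectPair_sub (f := fun z (_ : Fin L → Traj S A H) (_ : Fin t → Traj S A H) =>
    M.mismatch opt z * V₀ z.1) (g := fun z _ _ => M.mismatch opt z * M.value z.1 (opt z.2))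
    (fun _ _ => hm.mul (hVb.comp measurable_fst)) (fun _ _ => hm.mul hvb), hswap,
    ← expectPair_sub (f := fun z (_ : Fin L → Traj S A H) (_ : Fin t → Traj S A H) =>
    M.mismatch opt z * V₀ z.2) (g := fun z _ _ => M.mismatch opt z * M.value z.1 (opt z.2))
    (fun _ _ => hm.mul (hVb.comp measurable_snd)) (fun _ _ => hm.mul hvb)]
  have hpt : ∀ z, M.mismatch opt z * V₀ z.2 - M.mismatch opt z * M.value z.1 (opt z.2) ≤
      (H + 1) * (H / (2 * k) * M.mismatch opt z + k / 2 * D z) := by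
    intro z
    rw [← mul_sub, hval]
    have h1 := (le_abs_self _).trans
      (abs_value_sub_value_le (M := M) (θ' := z.2) (θ := z.1) (hpol z.2))
    have h2 := mul_le_mul_of_nonneg_left h1 (mismatch_nonneg (M := M) (opt := opt) z)
    refine h2.trans ?_
    rw [mul_left_comm]
    refine mul_le_mul_of_nonneg_left ?_ (by positivity)
    have h3 : ∀ w, M.mismatch opt z * M.transDist z w ≤
        1 / (2 * k) * M.mismatch opt z + k / 2 * M.transDist z w ^ 2 := by
      intro w
      -- Completing the square, using that an indicator equals its square.
      have e : 1 / (2 * k) * M.mismatch opt z + k / 2 * M.transDist z w ^ 2 -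
          M.mismatch opt z * M.transDist z w =
          1 / (2 * k) * (M.mismatch opt z - k * M.transDist z w) ^ 2 := by
        have hsq : M.mismatch opt z ^ 2 = M.mismatch opt z := by
          rcases mismatch_mem (M := M) (opt := opt) z with h | h <;> simp [h]
        rw [sub_sq, hsq]
        field_simp
        ring
      have : 0 ≤ 1 / (2 * k) * (M.mismatch opt z - k * M.transDist z w) ^ 2 := by positivity
      linarith
    calc _ = ∑ x, M.trajProb z.1 (opt z.2) x * ∑ h : Fin H,
          M.mismatch opt z * M.transDist z (h, x.1 h.castSucc, x.2 h) := by
          simp only [Finset.mul_sum, mul_left_comm (M.mismatch opt z), transDist]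
      _ ≤ ∑ x, M.trajProb z.1 (opt z.2) x * ∑ h : Fin H,
          (1 / (2 * k) * M.mismatch opt z +
            k / 2 * M.transDist z (h, x.1 h.castSucc, x.2 h) ^ 2) :=
          Finset.sum_le_sum fun x _ => mul_le_mul_of_nonneg_left
            (Finset.sum_le_sum fun h _ => h3 _) (trajProb_nonneg (hpol z.2) x)
      _ = _ := by
          simp only [Finset.sum_add_distrib, Finset.sum_const, Finset.card_univ,
            Fintype.card_fin, nsmul_eq_mul, mul_add, ← Finset.sum_mul, sum_trajProb (hpol z.2),
            one_mul, ← Finset.mul_sum, mul_left_comm _ (k / 2), hD]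
          ring
  refine (expectPair_mono hpol (fun _ _ => (hm.mul (hVb.comp measurable_snd)).sub (hm.mul hvb))
    (fun _ _ => ((hm.const_mul (H / (2 * k))).add (hDb.const_mul (k / 2))).const_mul (H + 1))
    fun z _ _ => hpt z).trans (le_of_eq ?_)
  rw [expectPair_const_mul, expectPair_add (f := fun z (_ : Fin L → Traj S A H)
    (_ : Fin t → Traj S A H) => H / (2 * k) * M.mismatch opt z)
    (g := fun z _ _ => k / 2 * D z) (fun _ _ => hm.const_mul _) (fun _ _ => hDb.const_mul _),
    expectPair_const_mul, expectPair_const_mul]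

/-- With total mismatch weight `a² = T H ε` and total squared error at most `b² = Y`, the choice `k
= a / b` gives `(H + 1) a b`; positivity of `ε` makes `k` positive. -/
theorem bayesRegret_le [Nonempty S] (hH : 1 ≤ H) (hopt : M.IsPlanner opt) (hgap : M.HasGap Δ)
    (hΔ : 0 < Δ) {T : ℕ} (hT : 1 ≤ T) {ε : ℝ} (hε0 : 0 < ε)
    (hε : ∀ t, M.expectPair opt μ₀ β (fun z (_ : Fin L → Traj S A H)
      (_ : Fin t → Traj S A H) => M.mismatch opt z) ≤ ε) :
    M.bayesRegret opt μ₀ β L T ≤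
      36 * (√(ε * (H : ℝ) ^ 4 * (Fintype.card S : ℝ) ^ 2 * (Fintype.card A : ℝ) * T) *
        (1 + Real.log T)) := by
  have hT1 : (1 : ℝ) ≤ T := by exact_mod_cast hT
  have hlog : 0 ≤ Real.log T := Real.log_nonneg hT1
  have hH1 : (1 : ℝ) ≤ H := by exact_mod_cast hH
  have hS : (1 : ℝ) ≤ Fintype.card S := by exact_mod_cast Fintype.card_pos
  have hA : (1 : ℝ) ≤ Fintype.card A := by exact_mod_cast Fintype.card_pos
  set l := Real.log T
  set nS : ℝ := (Fintype.card S : ℝ)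
  set nA : ℝ := (Fintype.card A : ℝ)
  set Y : ℝ := 320 * (H * nS ^ 2 * nA * (1 + l) ^ 2) with hY
  have hY0 : 0 < Y := by positivity
  have hE0 : 0 < T * H * ε := by positivity
  have ha : 0 < √(T * H * ε) := Real.sqrt_pos.2 hE0
  have hb : 0 < √Y := Real.sqrt_pos.2 hY0
  set a := √(T * H * ε) with ha_def
  set b := √Y with hb_def
  have hasq : a ^ 2 = T * H * ε := Real.sq_sqrt hE0.le
  have hbsq : b ^ 2 = Y := Real.sq_sqrt hY0.le
  have hk : 0 < a / b := div_pos ha hb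
  have h1 : M.bayesRegret opt μ₀ β L T ≤ (H + 1) * (a * b) := by
    rw [bayesRegret_eq_sum hopt]
    refine (Finset.sum_le_sum fun t _ => expectPair_regret_le hopt hgap hΔ t hk).trans ?_
    rw [← Finset.mul_sum, Finset.sum_add_distrib, ← Finset.mul_sum, ← Finset.mul_sum]
    refine mul_le_mul_of_nonneg_left ?_ (by positivity)
    have e1 := (Finset.sum_le_card_nsmul (Finset.range T) _ _ fun t _ => hε t)
    rw [Finset.card_range, nsmul_eq_mul] at e1
    have e2 := sum_expectPair_sq_transDist_le (M := M) (opt := opt) (μ₀ := μ₀) (β := β) (L := L)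
      hopt hT
    refine (add_le_add (mul_le_mul_of_nonneg_left e1 (by positivity))
      (mul_le_mul_of_nonneg_left e2 (by positivity))).trans (le_of_eq ?_)
    change (H : ℝ) / (2 * (a / b)) * (T * ε) + a / b / 2 * Y = a * b
    have e3 : (H : ℝ) / (2 * (a / b)) * (T * ε) = a ^ 2 * b / (2 * a) := by
      rw [hasq]
      field_simp
    rw [e3, ← hbsq]
    field_simp
    ring
  refine h1.trans ?_
  have h2 : (H + 1) * (a * b) ≤ 2 * H * (a * b) :=
    mul_le_mul_of_nonneg_right (by linarith) (by positivity)
  refine h2.trans (abs_le_of_sq_le_sq' ?_ (by positivity)).2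
  have h3 : 0 ≤ ε * (H : ℝ) ^ 4 * nS ^ 2 * nA * T := by positivity
  -- After squaring, the constants compare as `4 * 320 = 1280 ≤ 1296 = 36 ^ 2`.
  rw [mul_pow, mul_pow a, hasq, hbsq, mul_pow 36, mul_pow (√_), Real.sq_sqrt h3, hY]
  have h4 : 0 ≤ ε * (H : ℝ) ^ 4 * nS ^ 2 * nA * T * (1 + l) ^ 2 := by positivity
  nlinarith

end Regret

end MDPFamily

end

/-! ### The constants of the theorem -/

theorem mainTheorem1 :
    ∃ C : ℝ, 0 < C ∧
      ∀ (H nA : ℕ) (Δ p : ℝ), 1 ≤ H → 0 < Δ → 0 < p →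
        ∃ β₀ c : ℝ, 0 < c ∧
          ∀ (S A Θ : Type*) [Fintype S] [Fintype A] [Nonempty A] [MeasurableSpace Θ]
            (M : MDPFamily S A Θ H) (opt : Θ → Policy S A H)
            (μ₀ : Measure Θ) [IsProbabilityMeasure μ₀],
            Fintype.card A = nA → M.IsPlanner opt → M.HasGap Δ → M.minReachProb opt = p →
            ∀ (β : ℝ), 0 ≤ β → β₀ ≤ β → ∀ (T : ℕ), 1 ≤ T →
              (∀ L : ℕ, M.bayesRegret opt μ₀ β L T ≤
                C * (Real.sqrt (epsL (Fintype.card S) H p L * (H : ℝ) ^ 4 *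
                    (Fintype.card S : ℝ) ^ 2 * (Fintype.card A : ℝ) * (T : ℝ)) *
                  (1 + Real.log (T : ℝ)))) ∧
              ∃ K : ℝ, ∀ L : ℕ,
                |M.bayesRegret opt μ₀ β L T| ≤ K * Real.exp (-(c * ((L : ℝ) * (H : ℝ)))) := by
  -- The threshold on `β` says exactly that `2 H A exp (-β Δ) ≤ p / 10`. The rate is `p² / 36` per
  -- offline episode, divided by `H` because `N = L H`.
  refine ⟨36, by norm_num, fun H nA Δ p hH hΔ hp0 => ⟨Real.log (20 * H * nA / p) / Δ,
    p ^ 2 / (36 * H), by positivity, ?_⟩⟩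
  intro S A Θ _ _ _ _ M opt μ₀ _ hnA hopt hgap hmin β hβ hβ₀ T hT
  have hp : ∀ θ h s, 0 < M.stateProb θ (opt θ) h s → p ≤ M.stateProb θ (opt θ) h s := by
    intro θ h s hs
    rw [← hmin]
    exact csInf_le ⟨0, fun x hx => by obtain ⟨_, _, _, _, h⟩ := hx; exact h.le⟩
      ⟨θ, h, s, rfl, hs⟩
  have hSne : Nonempty S := by
    by_contra hcon
    rw [not_nonempty_iff] at hcon
    simpa using M.ν_mem.2
  have hp1 : p ≤ 1 := by
    obtain ⟨θ⟩ := nonempty_of_isProbabilityMeasure μ₀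
    have hpol := (hopt.optimal θ).1
    obtain ⟨s, -, hs⟩ : ∃ s ∈ Finset.univ, 0 < M.stateProb θ (opt θ) ⟨0, hH⟩ s := by
      refine Finset.exists_lt_of_sum_lt (f := fun _ => (0 : ℝ)) ?_
      rw [MDPFamily.sum_stateProb hpol]
      simp
    exact (hp _ _ _ hs).trans (MDPFamily.stateProb_le_one hpol _ _)
  have hβp : 2 * H * Fintype.card A * Real.exp (-(β * Δ)) ≤ p / 10 := by
    have hA : (1 : ℝ) ≤ nA := by rw [← hnA]; exact_mod_cast Fintype.card_pos
    have hH1 : (1 : ℝ) ≤ H := by exact_mod_cast hH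
    have hpos : 0 < 20 * H * nA / p := by positivity
    rw [div_le_iff₀ hΔ, Real.log_le_iff_le_exp hpos, div_le_iff₀ hp0] at hβ₀
    rw [hnA, Real.exp_neg, ← div_eq_mul_inv, div_le_iff₀ (Real.exp_pos _)]
    linarith
  have hε : ∀ L t, M.expectPair opt μ₀ β (fun z (_ : Fin L → Traj S A H)
      (_ : Fin t → Traj S A H) => M.mismatch opt z) ≤ epsL (Fintype.card S) H p L :=
    fun L t => MDPFamily.expectPair_mismatch_le hopt hgap hΔ hβ hp hp0 hp1 hH hβp
  refine ⟨fun L => MDPFamily.bayesRegret_le hH hopt hgap hΔ hT (MDPFamily.epsL_pos hH) (hε L),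
    -- This `K` grows linearly with `T` and is independent of `L`.
    T * ((H + 1) * (4 * Fintype.card S * H)), fun L => ?_⟩
  refine (MDPFamily.abs_bayesRegret_le hopt hgap hΔ (hε L)).trans ?_
  have h1 := MDPFamily.epsL_le_exp (L := L) hp0 hp1 hH (Fintype.card S)
  calc (T : ℝ) * ((H + 1) * epsL (Fintype.card S) H p L)
      ≤ T * ((H + 1) * (4 * Fintype.card S * H *
          Real.exp (-(p ^ 2 / (36 * H) * (L * H))))) := by gcongr
    _ = _ := by ring
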